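/- Let $e,Z,M>0$, $\Gamma=\mathbb Z^3$, $\Gamma^*=2\pi\mathbb Z^3$, $T^3=\mathbb R^3/\Gamma$, and let $\sigma:\mathbb R^3\to\mathbb R$ be an ion charge density with $\int_{\mathbb R^3}\sigma\,dx=eZ$ and $$(1+|x|^2)\,\sigma\in L^2(\mathbb R^3),\qquad (\Delta-1)\sigma\in L^1(\mathbb R^3),\tag{1}$$ derivatives being understood in the sense of distributions. Let $(\psi^0,\Phi^0,\omega^0)$ be a real ground state of the crystal with ions at the points of $\Gamma$: $\omega^0\in\mathbb R$, and $\psi^0,\Phi^0$ are real $\Gamma$-periodic functions, in $H^2(T^3)$, with $$\omega^0\psi^0=-\tfrac12\Delta\psi^0-e\Phi^0\psi^0,\qquad -\Delta\Phi^0=\sum_{n\in\Gamma}\sigma(\cdot-n)-e|\psi^0|^2,\qquad 0=-\langle\nabla\Phi^0,\sigma(\cdot-n)\rangle\quad(n\in\Gamma).$$ Let $G=(-\Delta)^{-1}$, let $G\nabla$ and $G\,\nabla\otimes\nabla$ be the corresponding Fourier multipliers on $\mathbb R^3$, let $l^2_3=l^2(\mathbb Z^3)\otimes\mathbb C^3$,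 and let $$\mathcal X=L^2(\mathbb R^3)\oplus L^2(\mathbb R^3)\oplus l^2_3\oplus l^2_3$$ (complex-valued functions). The energy operator (Hessian of the Hamilton functional at the ground state) acts on $Y=(\Psi_1,\Psi_2,Q,P)$ as the operator matrix $$B=\begin{pmatrix}2H^0+4e^2\psi^0G\psi^0&0&2S&0\\0&2H^0&0&0\\2S^*&0&T&0\\0&0&0&M^{-1}\end{pmatrix},\qquad H^0=-\tfrac12\Delta-e\Phi^0-\omega^0,$$ where $S$ has the kernel $S(x,n)=e\,\psi^0(x)\,G\nabla\sigma(x-n)$, $S^*$ is its formal adjoint, $[S^*\varphi](n)=\int\overline{S(x,n)}\,\varphi(x)\,dx$, and $T$ has the entries $$T(n,n')=-\langle G\,\nabla\otimes\nabla\sigma(\cdot-n'),\sigma(\cdot-n)\rangle+\langle\Phi^0,\nabla\otimes\nabla\sigma\rangle\,\delta_{nn'},$$ with $\langle\Phi^0,\partial_j\partial_k\sigma\rangle:=\int(\partial_j\partial_k\Phi^0)\,\sigma\,dx$. Let $\mathcal D\subset\mathcal X$ be the set of all $(\Psi_1,\Psi_2,Q,P)$ such that $\Psi_1,\Psi_2$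 are Schwartz functions whose Fourier transforms vanish in an $\varepsilon$-neighbourhood of $\Gamma^*$ for some $\varepsilon>0$, and $Q,P$ have finite support. Then $\mathcal D$ is dense in $\mathcal X$, $BY$ is well defined and belongs to $\mathcal X$ for every $Y\in\mathcal D$, and $B$ is bounded from below on $\mathcal D$: there is a constant $C$ such that, for every $Y\in\mathcal D$, the number $\langle Y,BY\rangle$ is real and $$\langle Y,BY\rangle\ \ge\ -C\,\|Y\|_{\mathcal X}^2 .$$ -/

import Mathlib

open MeasureTheory
open scoped FourierTransform ContDiff

noncomputable section

namespace Crystal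

/-! ### Spaces -/

/-- Physical space `ℝ³` with its Euclidean structure. -/
abbrev R3 : Type := EuclideanSpace ℝ (Fin 3)

/-- Index set of the lattice `Γ = ℤ³`. -/
abbrev Z3 : Type := Fin 3 → ℤ

/-- A lattice index seen as a point of `ℝ³`. -/
def latt (n : Z3) : R3 := WithLp.toLp 2 (fun k => (n k : ℝ))

/-- The `k`-th coordinate vector of `ℝ³`. -/
def basisVec (k : Fin 3) : R3 := EuclideanSpace.single k (1 : ℝ)

/-- `L²(ℝ³)`, complex valued. -/
abbrev L2 : Type := Lp ℂ 2 (volume : Measure R3)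

/-- `l²(ℤ³) ⊗ ℂ³`. -/
abbrev SeqL2 : Type := lp (fun _ : Z3 => EuclideanSpace ℂ (Fin 3)) 2

/-- The phase space `𝒳 = L²(ℝ³) ⊕ L²(ℝ³) ⊕ (l²(ℤ³) ⊗ ℂ³) ⊕ (l²(ℤ³) ⊗ ℂ³)`, the Hilbert sum. -/
abbrev Phase : Type := WithLp 2 (L2 × WithLp 2 (L2 × WithLp 2 (SeqL2 × SeqL2)))

/-- Component `Ψ₁` of `Y = (Ψ₁, Ψ₂, Q, P)`. -/
abbrev Phase.psi1 (Y : Phase) : L2 := Y.fst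
/-- Component `Ψ₂` of `Y = (Ψ₁, Ψ₂, Q, P)`. -/
abbrev Phase.psi2 (Y : Phase) : L2 := Y.snd.fst
/-- Component `Q` of `Y = (Ψ₁, Ψ₂, Q, P)`. -/
abbrev Phase.posn (Y : Phase) : SeqL2 := Y.snd.snd.fst
/-- Component `P` of `Y = (Ψ₁, Ψ₂, Q, P)`. -/
abbrev Phase.mom (Y : Phase) : SeqL2 := Y.snd.snd.snd

/-! ### Distributional derivatives -/

/-- Test functions: real valued, in `C_c^∞(ℝ³)`. -/
def IsTest (φ : R3 → ℝ) : Prop := ContDiff ℝ ∞ φ ∧ HasCompactSupport φ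

/-- The classical Laplacian of a function on `ℝ³`. -/
def lap (φ : R3 → ℝ) (x : R3) : ℝ :=
  ∑ k : Fin 3, iteratedFDeriv ℝ 2 φ x ![basisVec k, basisVec k]

/-- `g` is the weak (distributional) derivative `∂_{v 0} ⋯ ∂_{v (r-1)} f` on `ℝ³`. -/
def IsWeakDeriv {r : ℕ} (v : Fin r → R3) (f g : R3 → ℝ) : Prop :=
  LocallyIntegrable g volume ∧
    ∀ φ : R3 → ℝ, IsTest φ →
      ∫ x, f x * iteratedFDeriv ℝ r φ x v = (-1) ^ r * ∫ x, g x * φ x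

open Classical in
/-- The weak derivative `∂_{v 0} ⋯ ∂_{v (r-1)} f`, unique up to null sets when it exists (it exists
for all the functions and orders it is used for; the value is `0` otherwise). -/
def weakDeriv {r : ℕ} (v : Fin r → R3) (f : R3 → ℝ) : R3 → ℝ :=
  if h : ∃ g, IsWeakDeriv v f g then h.choose else 0

/-- `(Δ - 1) f ∈ L¹(ℝ³)` in the sense of distributions. -/
def LapSubOneMemL1 (f : R3 → ℝ) : Prop :=
  ∃ h : R3 → ℝ, Integrable h volume ∧
    ∀ φ : R3 → ℝ, IsTest φ → ∫ x, f x * (lap φ x - φ x) = ∫ x, h x * φ x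

/-! ### Periodic functions and the ground state -/

/-- The primitive cell `Π = [0,1]³`. -/
def cell : Set R3 := {x | ∀ k, 0 ≤ x k ∧ x k ≤ 1}

/-- Fourier coefficient `∫_Π e^{2πi m·x} f(x) dx` of a periodic function. -/
def perCoeff (f : R3 → ℝ) (m : Z3) : ℂ :=
  ∫ x in cell, Complex.exp (2 * Real.pi * Complex.I * (inner ℝ (latt m) x : ℝ)) * (f x : ℂ)

/-- `f` is a real function of the Sobolev space `H²(T³)`, `T³ = ℝ³/ℤ³`, seen as a `ℤ³`-periodic
function on `ℝ³`. -/
structure MemH2Per (f : R3 → ℝ) : Prop where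
  periodic : ∀ (n : Z3) (x : R3), f (x + latt n) = f x
  memLp : MemLp f 2 (volume.restrict cell)
  summable : Summable fun m : Z3 => (1 + ‖latt m‖ ^ 2) ^ 2 * ‖perCoeff f m‖ ^ 2

/-- The periodic charge density `∑ₙ σ(x - n)` of the ions. -/
def sigmaPer (σ : R3 → ℝ) (x : R3) : ℝ := ∑' n : Z3, σ (x - latt n)

/-- `(ψ⁰, Φ⁰, ω⁰)`, with the ions at the lattice points, is a real ground state: a `ℤ³`-periodic
stationary solution of the Schrödinger–Poisson–Newton equations, with equations in the sense of
distributions. -/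
structure IsGroundState (e : ℝ) (σ ψ Φ : R3 → ℝ) (freq : ℝ) : Prop where
  psi_mem : MemH2Per ψ
  Phi_mem : MemH2Per Φ
  /-- `ω⁰ ψ⁰ = -½ Δψ⁰ - e Φ⁰ ψ⁰` -/
  schrodinger : ∀ φ : R3 → ℝ, IsTest φ →
    ∫ x, ψ x * (-(1 / 2) * lap φ x) - e * Φ x * ψ x * φ x = ∫ x, freq * ψ x * φ x
  /-- `-ΔΦ⁰ = ∑ₙ σ(x - n) - e |ψ⁰|²` -/
  poisson : ∀ φ : R3 → ℝ, IsTest φ →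
    ∫ x, Φ x * (-lap φ x) = ∫ x, (sigmaPer σ x - e * ψ x ^ 2) * φ x
  /-- `0 = -⟨∇Φ⁰, σ(x - n)⟩` -/
  force : ∀ (n : Z3) (k : Fin 3),
    0 = -∫ x, weakDeriv ![basisVec k] Φ x * σ (x - latt n)

/-! ### Fourier multipliers

`𝓕` is the unitary Fourier transform of `L²(ℝ³)` with kernel `e^{-2πi η·x}`, so that `-Δ`
corresponds to `(2π|η|)²` and `∂ₖ` to `2πi ηₖ`. -/

/-- `f ∈ L²(ℝ³)` lies in the natural domain of the multiplier with symbol `a`, and `v` is its image: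
`v = 𝓕⁻¹ (a · 𝓕 f)`. -/
def IsMultiplier (a : R3 → ℂ) (f : R3 → ℂ) (v : L2) : Prop :=
  ∃ u : L2, u =ᵐ[volume] f ∧
    (𝓕 v : L2) =ᵐ[volume] fun η => a η * (𝓕 u : L2) η

/-- Symbol of `-Δ`. -/
def symbNegLap (η : R3) : ℂ := (2 * Real.pi * ‖η‖ : ℝ) ^ 2

/-- Symbol of `∂ₖ`. -/
def symbPartial (k : Fin 3) (η : R3) : ℂ := 2 * Real.pi * Complex.I * (η k : ℂ)

/-- Symbol of `G = (-Δ)⁻¹` (the point `η = 0` is a null set). -/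
def symbG (η : R3) : ℂ := (symbNegLap η)⁻¹

/-! ### The energy operator -/

/-- The entries `T(n,n')_{jk} = -⟨G ∂ⱼ∂ₖ σ(·-n'), σ(·-n)⟩ + ⟨Φ⁰, ∂ⱼ∂ₖ σ⟩ δ_{nn'}`, where
`R n' j k` stands for the function `G ∂ⱼ∂ₖ σ(·-n')`. The distributional pairing `⟨Φ⁰, ∂ⱼ∂ₖ σ⟩`
is the integral of `σ` against the second derivative of `Φ⁰ ∈ H²(T³)`. -/
def matT (σ Φ : R3 → ℝ) (R : Z3 → Fin 3 → Fin 3 → L2) (n n' : Z3) (j k : Fin 3) : ℂ :=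
  -(∫ x, R n' j k x * (σ (x - latt n) : ℂ)) +
    if n = n' then
      ((∫ x, weakDeriv ![basisVec j, basisVec k] Φ x * σ x : ℝ) : ℂ)
    else 0

/-- `W = B Y` for `Y = (Ψ₁, Ψ₂, Q, P)` with finitely supported `Q`, where
```
    ( 2H⁰ + 4e²ψ⁰Gψ⁰   0     2S    0  )
B = ( 0                2H⁰   0     0  )
    ( 2S*              0     T     0  )
    ( 0                0     0    M⁻¹ )
```
with `H⁰ = -½Δ - eΦ⁰ - ω⁰`, and `S` given by the kernel `S(x,n) = e ψ⁰(x) G∇σ(x-n)`.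
In particular all terms are required to be defined, and the result to lie in `𝒳`.
Here `D₁ = -ΔΨ₁`, `D₂ = -ΔΨ₂`, `N = G(ψ⁰Ψ₁)`, `K n k = G∂ₖσ(·-n)` and `R n j k = G∂ⱼ∂ₖσ(·-n)`. -/
def IsHessian (e M : ℝ) (σ ψ Φ : R3 → ℝ) (freq : ℝ) (Y W : Phase) : Prop :=
  ∃ (D₁ D₂ N : L2) (K : Z3 → Fin 3 → L2) (R : Z3 → Fin 3 → Fin 3 → L2),
    IsMultiplier symbNegLap Y.psi1 D₁ ∧
    IsMultiplier symbNegLap Y.psi2 D₂ ∧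
    IsMultiplier symbG (fun x => (ψ x : ℂ) * Y.psi1 x) N ∧
    (∀ n k, IsMultiplier (fun η => symbG η * symbPartial k η)
      (fun x => (σ (x - latt n) : ℂ)) (K n k)) ∧
    (∀ n j k, IsMultiplier (fun η => symbG η * symbPartial j η * symbPartial k η)
      (fun x => (σ (x - latt n) : ℂ)) (R n j k)) ∧
    (W.psi1 =ᵐ[volume] fun x =>
      2 * ((1 / 2) * D₁ x - e * Φ x * Y.psi1 x - freq * Y.psi1 x)
        + 4 * e ^ 2 * ψ x * N x
        + 2 * ∑' n, ∑ k, e * ψ x * K n k x * Y.posn n k) ∧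
    (W.psi2 =ᵐ[volume] fun x =>
      2 * ((1 / 2) * D₂ x - e * Φ x * Y.psi2 x - freq * Y.psi2 x)) ∧
    (∀ n j, W.posn n j =
      2 * (∫ x, (starRingEnd ℂ) (e * ψ x * K n j x) * Y.psi1 x)
        + ∑' n', ∑ k, matT σ Φ R n n' j k * Y.posn n' k) ∧
    (∀ n j, W.mom n j = (M : ℂ)⁻¹ * Y.mom n j)

/-! ### The domain -/

/-- `𝒮₊`: Schwartz functions whose Fourier transform `∫ e^{iξ·x} φ(x) dx`, which is
`𝓕 φ (-ξ/2π)`, vanishes in an `ε`-neighbourhood of `Γ* = 2πℤ³` for some `ε > 0`. -/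
def schwartzPlus : Set (SchwartzMap R3 ℂ) :=
  {φ | ∃ ε > 0, ∀ (ξ : R3) (m : Z3), dist ξ ((2 * Real.pi) • latt m) < ε →
    (𝓕 φ : SchwartzMap R3 ℂ) (-((2 * Real.pi)⁻¹ • ξ)) = 0}

/-- `l_c`: sequences `Q` with `Q(n) = 0` for `|n| > R`, for some `R`. -/
def seqFin : Set SeqL2 := {Q | ∃ R : ℕ, ∀ n : Z3, (R : ℝ) < ‖latt n‖ → Q n = 0}

/-- The domain `𝒟` of `Y = (Ψ₁, Ψ₂, Q, P)` with `Ψ₁, Ψ₂ ∈ 𝒮₊` and `Q, P ∈ l_c`. -/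
def core : Set Phase :=
  {Y | (∃ φ ∈ schwartzPlus, Y.psi1 = φ.toLp 2) ∧ (∃ φ ∈ schwartzPlus, Y.psi2 = φ.toLp 2) ∧
    Y.posn ∈ seqFin ∧ Y.mom ∈ seqFin}

end Crystal

end

open Crystal

noncomputable section

namespace Crystal

/-! The lower bound comes from completing a square. Put `A = (-Δ)^{-1/2}(ψ⁰Ψ₁)` and `T = ∑ₙ ∑ₖ Qₖ(n)
(-Δ)^{1/2} G∂ₖσ(·-n)`. The `4e²ψ⁰Gψ⁰` block contributes `4e²⟨A, A⟩`, the coupling through `S` and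
`S*` contributes `2e⟨A, T⟩ + 2e⟨T, A⟩`, and the matrix entries `-⟨G∂ⱼ∂ₖσ(·-n'), σ(·-n)⟩` are Gram
products summing to `⟨T, T⟩`. Together they are `‖2eA + T‖² ≥ 0` (`energy_form_eq`). What remains is
harmless: `-Δ ≥ 0`, the potential `Φ⁰` is bounded because `H²(T³)` functions have absolutely
convergent Fourier series, the on-site term is a fixed real symmetric `3 × 3` matrix, and `M⁻¹‖P‖² ≥
0`.

For `BY` to exist, the singularity of `G` at frequency zero must be controlled. The transform of
`ψ⁰Ψ₁` is a superposition of lattice translates of that of `Ψ₁`, so it vanishes near the origin and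
`G(ψ⁰Ψ₁)` is defined (`MemH2Per.fourier_mul_eq_zero`). The weight puts `σ` in `L¹ ∩ L²`, so `G∂ₖσ`
has only a `|η|⁻¹` singularity, square integrable in dimension three. The `l²` components are
pairings of fixed `L²` functions with the translates `σ(·-n)`, square summable thanks to the weight
(`summable_sq_integral_translates`).

Density on the Fourier side reduces to the lattice being closed and of measure zero. -/

/-! ### Lattice geometry and lattice sums of the weights. -/

lemma latt_apply (n : Z3) (k : Fin 3) : latt n k = n k := rfl

lemma latt_neg (m : Z3) : latt (-m) = -latt m := by
  ext k; simp [latt_apply]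

lemma latt_sub (m n : Z3) : latt (m - n) = latt m - latt n := by
  ext k; simp [latt_apply]

lemma latt_zero : latt 0 = 0 := by
  ext k; simp [latt_apply]

lemma latt_injective : Function.Injective latt := by
  intro m n h
  funext k
  have := congrArg (fun x : R3 => x k) h
  simpa [latt_apply] using this

/-- The points of `ℤ³` as a `ℤ`-submodule of `ℝ³`. -/
abbrev lattSpan : Submodule ℤ R3 :=
  Submodule.span ℤ (Set.range (EuclideanSpace.basisFun (Fin 3) ℝ).toBasis)

lemma latt_mem_lattSpan (m : Z3) : latt m ∈ lattSpan := by
  rw [← (EuclideanSpace.basisFun (Fin 3) ℝ).sum_repr (latt m)]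
  refine Submodule.sum_mem _ fun k _ => ?_
  have : ((EuclideanSpace.basisFun (Fin 3) ℝ).repr (latt m) k)
      • (EuclideanSpace.basisFun (Fin 3) ℝ) k = (m k) • (EuclideanSpace.basisFun (Fin 3) ℝ) k := by
    simp only [EuclideanSpace.basisFun_repr, latt_apply, Int.cast_smul_eq_zsmul]
  rw [this]
  exact Submodule.smul_mem _ _ (Submodule.subset_span ⟨k, by simp⟩)

lemma finrank_lattSpan : Module.finrank ℤ lattSpan = 3 := by
  have h : LinearIndependent ℤ (EuclideanSpace.basisFun (Fin 3) ℝ).toBasis :=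
    (EuclideanSpace.basisFun (Fin 3) ℝ).toBasis.linearIndependent.restrict_scalars
      fun a b h => by simpa using h
  exact (finrank_span_eq_card h).trans (by simp)

/-- The weights `(1 + |x|²)⁻²` are summable over the lattice. -/
lemma summable_lattice_weight : Summable fun m : Z3 => ((1 + ‖latt m‖ ^ 2) ^ 2)⁻¹ := by
  have h := ZLattice.summable_norm_pow_inv lattSpan 4 (by rw [finrank_lattSpan]; norm_num)
  have h2 : Summable fun m : Z3 => ‖latt m‖⁻¹ ^ 4 :=
    h.comp_injective (i := fun m : Z3 => (⟨latt m, latt_mem_lattSpan m⟩ : lattSpan))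
      (fun m n hmn => latt_injective (congrArg Subtype.val hmn))
  -- At the origin `‖latt m‖⁻¹ ^ 4` is `0` by convention while the weight is `1`; the extra summand
  -- supplies that term.
  have h3 : Summable fun m : Z3 => ‖latt m‖⁻¹ ^ 4 + if m = 0 then (1 : ℝ) else 0 :=
    h2.add (hasSum_ite_eq (0 : Z3) (1 : ℝ)).summable
  refine Summable.of_nonneg_of_le (fun m => by positivity) (fun m => ?_) h3
  by_cases hm : m = 0
  · simp [hm, latt_zero]
  · have h0 : 0 < ‖latt m‖ := by
      rw [norm_pos_iff, ← latt_zero]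
      exact fun h => hm (latt_injective h)
    simp only [hm, if_false, add_zero, inv_pow]
    apply inv_anti₀ (by positivity)
    nlinarith [sq_nonneg (‖latt m‖)]

lemma exists_latt_near (x : R3) : ∃ m : Z3, ‖x - latt m‖ ^ 2 ≤ 1 := by
  refine ⟨fun k => round (x k), ?_⟩
  rw [EuclideanSpace.norm_sq_eq]
  have : ∀ k, ‖(x - latt fun k => round (x k)) k‖ ^ 2 ≤ 1 / 4 := fun k => by
    have := abs_sub_round (x k)
    simp only [PiLp.sub_apply, latt_apply, Real.norm_eq_abs]
    nlinarith [abs_nonneg (x k - round (x k))]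
  calc _ ≤ ∑ k : Fin 3, (1 / 4 : ℝ) := Finset.sum_le_sum fun k _ => this k
    _ ≤ 1 := by simp; norm_num

/-- The lattice sums of the shifted weights are bounded uniformly in the shift. -/
lemma tsum_lattice_weight_le (x : R3) :
    ∑' n : Z3, ENNReal.ofReal (((1 + ‖x - latt n‖ ^ 2) ^ 2)⁻¹) ≤
      ENNReal.ofReal (9 * ∑' m : Z3, ((1 + ‖latt m‖ ^ 2) ^ 2)⁻¹) := by
  obtain ⟨m, hm⟩ := exists_latt_near x
  have hs := summable_lattice_weight
  have hle : ∀ n : Z3, ENNReal.ofReal (((1 + ‖x - latt n‖ ^ 2) ^ 2)⁻¹) ≤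
      ENNReal.ofReal (9 * ((1 + ‖latt (n - m)‖ ^ 2) ^ 2)⁻¹) := fun n => by
    apply ENNReal.ofReal_le_ofReal
    have h1 : ‖latt (n - m)‖ ≤ ‖x - latt n‖ + ‖x - latt m‖ := by
      have : latt (n - m) = (x - latt m) - (x - latt n) := by rw [latt_sub]; abel
      rw [this]
      linarith [norm_sub_le (x - latt m) (x - latt n)]
    -- With `a = ‖x - latt n‖` and `‖x - latt m‖ ≤ 1`, one has `1 + (a + 1)² ≤ 3 + 2a² ≤ 3(1 + a²)`.
    -- Squaring gives the constant `9`.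
    have h2 : 1 + ‖latt (n - m)‖ ^ 2 ≤ 3 * (1 + ‖x - latt n‖ ^ 2) := by
      nlinarith [norm_nonneg (latt (n - m)), norm_nonneg (x - latt n), norm_nonneg (x - latt m),
        sq_nonneg (‖x - latt n‖ - ‖x - latt m‖)]
    rw [← div_eq_mul_inv, le_div_iff₀ (by positivity), inv_mul_le_iff₀ (by positivity)]
    calc _ ≤ (3 * (1 + ‖x - latt n‖ ^ 2)) ^ 2 := by gcongr
      _ = _ := by ring
  calc _ ≤ ∑' n : Z3, ENNReal.ofReal (9 * ((1 + ‖latt (n - m)‖ ^ 2) ^ 2)⁻¹) :=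
        ENNReal.tsum_le_tsum hle
    _ = ∑' n : Z3, ENNReal.ofReal (9 * ((1 + ‖latt n‖ ^ 2) ^ 2)⁻¹) :=
        (Equiv.subRight m).tsum_eq fun n : Z3 => ENNReal.ofReal (9 * ((1 + ‖latt n‖ ^ 2) ^ 2)⁻¹)
    _ = _ := by
        rw [← ENNReal.ofReal_tsum_of_nonneg (fun n => by positivity) (hs.mul_left 9), tsum_mul_left]

/-! ### Weighted square integrability of the charge density -/

section Density

variable {σ : R3 → ℝ}

lemma aestronglyMeasurable_of_weight
    (hσ : MemLp (fun x => (1 + ‖x‖ ^ 2) * σ x) 2 (volume : Measure R3)) :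
    AEStronglyMeasurable σ volume := by
  have : σ = fun x => (1 + ‖x‖ ^ 2)⁻¹ * ((1 + ‖x‖ ^ 2) * σ x) := by
    funext x
    have : (1 + ‖x‖ ^ 2) ≠ 0 := by positivity
    field_simp
  rw [this]
  refine AEStronglyMeasurable.mul (Continuous.aestronglyMeasurable ?_) hσ.1
  exact Continuous.inv₀ (by fun_prop) fun x => by positivity

lemma memLp_two_of_weight
    (hσ : MemLp (fun x => (1 + ‖x‖ ^ 2) * σ x) 2 (volume : Measure R3)) :
    MemLp σ 2 volume := by
  refine hσ.mono (aestronglyMeasurable_of_weight hσ) (Filter.Eventually.of_forall fun x => ?_)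
  rw [norm_mul, Real.norm_of_nonneg (by positivity : 0 ≤ 1 + ‖x‖ ^ 2)]
  nlinarith [norm_nonneg (σ x), mul_nonneg (sq_nonneg ‖x‖) (norm_nonneg (σ x))]

/-- The square decays like `|x|⁻⁴`, and `4 > 3`. By Cauchy–Schwarz this turns the weighted `L²`
bound on `σ` into `σ ∈ L¹`. -/
lemma memLp_two_weight_inv : MemLp (fun x : R3 => (1 + ‖x‖ ^ 2)⁻¹) 2 volume := by
  rw [memLp_two_iff_integrable_sq]
  · have := integrable_rpow_neg_one_add_norm_sq (E := R3) (μ := volume) (r := 4) (by simp; norm_num)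
    refine this.congr (Filter.Eventually.of_forall fun x => ?_)
    have h : (0:ℝ) ≤ 1 + ‖x‖ ^ 2 := by positivity
    simp only
    rw [show (-4 / 2 : ℝ) = -(2 : ℕ) by norm_num, Real.rpow_neg h, Real.rpow_natCast, inv_pow]
  · exact (Continuous.inv₀ (by fun_prop) fun x => by positivity).aestronglyMeasurable

lemma integrable_of_weight
    (hσ : MemLp (fun x => (1 + ‖x‖ ^ 2) * σ x) 2 (volume : Measure R3)) :
    Integrable σ volume := by
  refine (hσ.integrable_mul memLp_two_weight_inv).congr (Filter.Eventually.of_forall fun x => ?_)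
  have : (1 + ‖x‖ ^ 2) ≠ 0 := by positivity
  simp only [Pi.mul_apply]
  field_simp

/-- Bessel-type inequality for the lattice translates of a weighted square integrable function. -/
lemma summable_sq_integral_translates
    (hσ : MemLp (fun x => (1 + ‖x‖ ^ 2) * σ x) 2 (volume : Measure R3)) (u : L2) :
    Summable fun n : Z3 => ‖∫ x, u x * (σ (x - latt n) : ℂ)‖ ^ 2 := by
  have hm := aestronglyMeasurable_of_weight hσ
  set w : R3 → ENNReal := fun x => ENNReal.ofReal (1 + ‖x‖ ^ 2) with hw
  have hwm : Measurable w := by fun_prop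
  have hw0 : ∀ x, w x ≠ 0 := fun x => by
    simp only [hw, ne_eq, ENNReal.ofReal_eq_zero, not_le]; positivity
  have hwt : ∀ x, w x ≠ ⊤ := fun x => ENNReal.ofReal_ne_top
  have hwinv : ∀ x, (w x)⁻¹ ^ (2:ℝ) = ENNReal.ofReal (((1 + ‖x‖ ^ 2) ^ 2)⁻¹) := fun x => by
    simp only [hw]
    rw [ENNReal.ofReal_inv_of_pos (by positivity), ENNReal.ofReal_pow (by positivity)]
    rw [ENNReal.inv_rpow]; norm_cast
  set A : ENNReal := ∫⁻ x, (w x * ‖σ x‖ₑ) ^ (2:ℝ) with hA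
  have hAt : A < ⊤ := by
    have := (eLpNorm_lt_top_iff_lintegral_rpow_enorm_lt_top (by norm_num) (by norm_num)).1 hσ.2
    simp only [ENNReal.toReal_ofNat] at this
    refine lt_of_eq_of_lt (lintegral_congr fun x => ?_) this
    congr 1
    rw [enorm_mul, Real.enorm_of_nonneg (by positivity : 0 ≤ 1 + ‖x‖ ^ 2)]
  set U : ENNReal := ∫⁻ x, ‖u x‖ₑ ^ (2:ℝ) with hU
  have hUt : U < ⊤ := by
    have := (eLpNorm_lt_top_iff_lintegral_rpow_enorm_lt_top (by norm_num) (by norm_num)).1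
      (Lp.memLp u).2
    simpa only [ENNReal.toReal_ofNat] using this
  have hum : AEMeasurable (fun x => ‖u x‖ₑ) volume := (Lp.aestronglyMeasurable u).enorm
  have hsm : AEMeasurable (fun x => ‖σ x‖ₑ) volume := hm.enorm
  have hsub : ∀ n : Z3, MeasurePreserving (fun x : R3 => x - latt n) volume volume :=
    fun n => measurePreserving_sub_right volume (latt n)
  -- Cauchy–Schwarz with the weight centred at `n` inserted: the factor containing `σ` has a norm
  -- independent of `n`, and the other factor localizes `u` near `n`.
  have key : ∀ n : Z3, ‖∫ x, u x * (σ (x - latt n) : ℂ)‖ₑ ^ (2:ℝ) ≤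
      (∫⁻ x, ‖u x‖ₑ ^ (2:ℝ) * ENNReal.ofReal (((1 + ‖x - latt n‖ ^ 2) ^ 2)⁻¹)) * A := fun n => by
    have h1 : ‖∫ x, u x * (σ (x - latt n) : ℂ)‖ₑ ≤
        ∫⁻ x, (‖u x‖ₑ * (w (x - latt n))⁻¹) * (w (x - latt n) * ‖σ (x - latt n)‖ₑ) := by
      refine (enorm_integral_le_lintegral_enorm _).trans (le_of_eq (lintegral_congr fun x => ?_))
      rw [enorm_mul, mul_assoc, ← mul_assoc _ (w _), ENNReal.inv_mul_cancel (hw0 _) (hwt _), one_mul]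
      congr 1
      simp only [← ofReal_norm, Complex.norm_real]
    have h2 := ENNReal.lintegral_mul_le_Lp_mul_Lq volume Real.HolderConjugate.two_two
      (f := fun x => ‖u x‖ₑ * (w (x - latt n))⁻¹)
      (g := fun x => w (x - latt n) * ‖σ (x - latt n)‖ₑ)
      (hum.mul (by fun_prop))
      (AEMeasurable.mul (by fun_prop) (hsm.comp_quasiMeasurePreserving
        (hsub n).quasiMeasurePreserving))
    have h3 : ∫⁻ x, (w (x - latt n) * ‖σ (x - latt n)‖ₑ) ^ (2:ℝ) = A := by
      rw [hA, ← lintegral_sub_right_eq_self (fun x => (w x * ‖σ x‖ₑ) ^ (2:ℝ)) (latt n)]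
    have h4 : ∫⁻ x, (‖u x‖ₑ * (w (x - latt n))⁻¹) ^ (2:ℝ) =
        ∫⁻ x, ‖u x‖ₑ ^ (2:ℝ) * ENNReal.ofReal (((1 + ‖x - latt n‖ ^ 2) ^ 2)⁻¹) :=
      lintegral_congr fun x => by
        rw [ENNReal.mul_rpow_of_nonneg _ _ (by norm_num), hwinv]
    have h5 := h1.trans h2
    rw [h3, h4] at h5
    calc _ ≤ ((∫⁻ x, ‖u x‖ₑ ^ (2:ℝ) * ENNReal.ofReal (((1 + ‖x - latt n‖ ^ 2) ^ 2)⁻¹)) ^ (1 / 2 : ℝ)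
          * A ^ (1 / 2 : ℝ)) ^ (2:ℝ) := by gcongr
      _ = _ := by
          rw [ENNReal.mul_rpow_of_nonneg _ _ (by norm_num), ← ENNReal.rpow_mul, ← ENNReal.rpow_mul]
          norm_num
  -- By Tonelli the lattice sum moves inside, where it is bounded uniformly in `x`; only `‖u‖²` is
  -- left.
  have hsum : ∑' n : Z3, ‖∫ x, u x * (σ (x - latt n) : ℂ)‖ₑ ^ (2:ℝ) < ⊤ := by
    calc _ ≤ ∑' n : Z3,
          (∫⁻ x, ‖u x‖ₑ ^ (2:ℝ) * ENNReal.ofReal (((1 + ‖x - latt n‖ ^ 2) ^ 2)⁻¹)) * A :=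
          ENNReal.tsum_le_tsum key
      _ = (∫⁻ x, ∑' n : Z3,
          ‖u x‖ₑ ^ (2:ℝ) * ENNReal.ofReal (((1 + ‖x - latt n‖ ^ 2) ^ 2)⁻¹)) * A := by
          rw [ENNReal.tsum_mul_right, lintegral_tsum]
          intro n
          exact (hum.pow_const _).mul (by fun_prop)
      _ ≤ (∫⁻ x, ‖u x‖ₑ ^ (2:ℝ) *
          ENNReal.ofReal (9 * ∑' m : Z3, ((1 + ‖latt m‖ ^ 2) ^ 2)⁻¹)) * A := by
          gcongr with x
          rw [ENNReal.tsum_mul_left]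
          gcongr
          exact tsum_lattice_weight_le x
      _ < ⊤ := by
          rw [lintegral_mul_const' _ _ ENNReal.ofReal_ne_top]
          exact ENNReal.mul_lt_top (ENNReal.mul_lt_top hUt ENNReal.ofReal_lt_top) hAt
  have := ENNReal.summable_toReal hsum.ne
  refine this.congr fun n => ?_
  rw [← ENNReal.toReal_rpow]
  simp

end Density

/-! ### The Fourier transform on `L¹ ∩ L²` -/

lemma integral_fourier_mul_eq_of_integrable {f g : R3 → ℂ} (hf : Integrable f)
    (hg : Integrable g) : ∫ ξ, 𝓕 f ξ * g ξ = ∫ x, f x * 𝓕 g x := by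
  have := VectorFourier.integral_fourierIntegral_smul_eq_flip (L := innerₗ R3)
    Real.continuous_fourierChar continuous_inner hf hg
  simp only [flip_innerₗ, smul_eq_mul] at this
  exact this

lemma continuous_fourier_of_integrable {f : R3 → ℂ} (hf : Integrable f) : Continuous (𝓕 f) :=
  VectorFourier.fourierIntegral_continuous Real.continuous_fourierChar
    (by exact continuous_inner) hf

lemma norm_fourier_le_integral_norm (f : R3 → ℂ) (η : R3) : ‖𝓕 f η‖ ≤ ∫ x, ‖f x‖ :=
  VectorFourier.norm_fourierIntegral_le_integral_norm _ _ _ _ _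

/-- On `L¹ ∩ L²`, the Plancherel transform is given by the Fourier integral. -/
lemma fourier_toLp_ae_eq {f : R3 → ℂ} (h1 : Integrable f) (h2 : MemLp f 2 volume) :
    (𝓕 (h2.toLp f) : L2) =ᵐ[volume] 𝓕 f := by
  have hl : LocallyIntegrable (𝓕 (h2.toLp f) : L2) volume :=
    (Lp.memLp (𝓕 (h2.toLp f) : L2)).locallyIntegrable (by norm_num)
  refine ae_eq_of_integral_contDiff_smul_eq hl
    (continuous_fourier_of_integrable h1).locallyIntegrable fun g hg hgc => ?_
  have hgC : ContDiff ℝ ∞ fun x => (g x : ℂ) := Complex.ofRealCLM.contDiff.comp hg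
  have hgcC : HasCompactSupport fun x => (g x : ℂ) := hgc.comp_left (g := Complex.ofReal) rfl
  set φ : SchwartzMap R3 ℂ := hgcC.toSchwartzMap hgC with hφ
  have hφa : ∀ x, φ x = (g x : ℂ) := fun x => rfl
  -- Both transforms are identified by testing: the Plancherel transform passes to the test function
  -- as a tempered distribution, the Fourier integral by Fubini.
  have hT := congrArg (fun T => T φ) (Lp.fourier_toTemperedDistribution_eq (h2.toLp f))
  simp only [TemperedDistribution.fourier_apply, Lp.toTemperedDistribution_apply,
    smul_eq_mul, hφa] at hT
  simp only [Complex.real_smul]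
  rw [← hT]
  have h3 := integral_fourier_mul_eq_of_integrable h1 (φ.integrable (μ := volume))
  have h4 : ∫ x, (g x : ℂ) * 𝓕 f x = ∫ ξ, 𝓕 f ξ * φ ξ :=
    integral_congr_ae (Filter.Eventually.of_forall fun x => by simp only [hφa, mul_comm])
  rw [h4, h3]
  refine integral_congr_ae ?_
  filter_upwards [h2.coeFn_toLp] with x hx
  rw [hx, mul_comm, SchwartzMap.fourier_coe]

/-! ### Fourier multipliers -/

lemma isMultiplier_of_memLp {a : R3 → ℂ} {f : R3 → ℂ} (hf : MemLp f 2 volume)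
    (h : MemLp (fun η => a η * (𝓕 (hf.toLp f) : L2) η) 2 volume) : ∃ v, IsMultiplier a f v := by
  refine ⟨𝓕⁻ (h.toLp _), hf.toLp f, hf.coeFn_toLp, ?_⟩
  rw [FourierTransform.fourier_fourierInv_eq]
  exact h.coeFn_toLp

lemma IsMultiplier.memLp {a f : R3 → ℂ} {v : L2} (h : IsMultiplier a f v) : MemLp f 2 volume := by
  obtain ⟨u, hu, -⟩ := h
  exact (memLp_congr_ae hu).1 (Lp.memLp u)

lemma IsMultiplier.fourier_ae_eq {a f : R3 → ℂ} {v : L2} (h : IsMultiplier a f v)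
    (hf : MemLp f 2 volume) :
    (𝓕 v : L2) =ᵐ[volume] fun η => a η * (𝓕 (hf.toLp f) : L2) η := by
  obtain ⟨u, hu, hv⟩ := h
  have : u = hf.toLp f := Lp.ext (hu.trans hf.coeFn_toLp.symm)
  rwa [← this]

/-- The symbol and `f` fix the transform of the image, and the Plancherel transform is injective.
Uniqueness of `BY` rests on this. -/
lemma IsMultiplier.unique {a f : R3 → ℂ} {v w : L2} (hv : IsMultiplier a f v)
    (hw : IsMultiplier a f w) : v = w :=
  (Lp.fourierTransformₗᵢ R3 ℂ).injective
    (Lp.ext ((hv.fourier_ae_eq hv.memLp).trans (hw.fourier_ae_eq hv.memLp).symm))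

/-! ### The symbols -/

lemma measurable_symbNegLap : Measurable symbNegLap := by
  unfold symbNegLap; fun_prop

lemma measurable_symbG : Measurable symbG := measurable_symbNegLap.inv

lemma measurable_symbPartial (k : Fin 3) : Measurable (symbPartial k) := by
  unfold symbPartial; fun_prop

lemma norm_symbNegLap (η : R3) : ‖symbNegLap η‖ = (2 * Real.pi * ‖η‖) ^ 2 := by
  rw [symbNegLap, norm_pow, Complex.norm_real, Real.norm_of_nonneg (by positivity)]

lemma norm_symbG (η : R3) : ‖symbG η‖ = ((2 * Real.pi * ‖η‖) ^ 2)⁻¹ := by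
  rw [symbG, norm_inv, norm_symbNegLap]

lemma norm_symbPartial_le (k : Fin 3) (η : R3) : ‖symbPartial k η‖ ≤ 2 * Real.pi * ‖η‖ := by
  rw [symbPartial]
  simp only [norm_mul, Complex.norm_ofNat, Complex.norm_real, Complex.norm_I, mul_one,
    Real.norm_of_nonneg Real.pi_pos.le]
  gcongr
  exact PiLp.norm_apply_le η k

lemma norm_symbG_mul_symbPartial_le (k : Fin 3) (η : R3) :
    ‖symbG η * symbPartial k η‖ ≤ ‖η‖⁻¹ := by
  rw [norm_mul, norm_symbG]
  have hpi : 1 ≤ 2 * Real.pi := by linarith [Real.pi_gt_three]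
  by_cases h0 : ‖η‖ = 0
  · simp [h0]
  have hη : 0 < ‖η‖ := lt_of_le_of_ne (norm_nonneg _) (Ne.symm h0)
  calc _ ≤ ((2 * Real.pi * ‖η‖) ^ 2)⁻¹ * (2 * Real.pi * ‖η‖) := by
        gcongr; exact norm_symbPartial_le k η
    _ = (2 * Real.pi)⁻¹ * ‖η‖⁻¹ := by field_simp
    _ ≤ 1 * ‖η‖⁻¹ := by gcongr; exact inv_le_one_of_one_le₀ hpi
    _ = _ := one_mul _

/-- Two derivatives compensate `G` exactly. At `η = 0` the bound holds because `0⁻¹ = 0`. -/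
lemma norm_symbG_mul_symbPartial_mul_symbPartial_le (j k : Fin 3) (η : R3) :
    ‖symbG η * symbPartial j η * symbPartial k η‖ ≤ 1 := by
  rw [norm_mul, norm_mul, norm_symbG]
  by_cases h0 : ‖η‖ = 0
  · simp [h0]
  have hη : 0 < ‖η‖ := lt_of_le_of_ne (norm_nonneg _) (Ne.symm h0)
  calc _ ≤ ((2 * Real.pi * ‖η‖) ^ 2)⁻¹ * (2 * Real.pi * ‖η‖) * (2 * Real.pi * ‖η‖) := by
        gcongr
        · exact norm_symbPartial_le j η
        · exact norm_symbPartial_le k η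
    _ = 1 := by have := Real.pi_pos; field_simp

/-- Square integrability of a function with a singularity `|η|⁻¹` at the origin of `ℝ³`. -/
lemma memLp_two_of_le_inv_norm {f g : R3 → ℂ} (hf : AEStronglyMeasurable f volume) {C : ℝ}
    (hC : ∀ᵐ η, ‖f η‖ ≤ C * ‖η‖⁻¹) (hg : MemLp g 2 volume)
    (h : ∀ᵐ η, 1 ≤ ‖η‖ → ‖f η‖ ≤ ‖g η‖) : MemLp f 2 volume := by
  rw [memLp_two_iff_integrable_sq_norm hf]
  have h1 : IntegrableOn (fun η : R3 => ‖f η‖ ^ 2) (Metric.ball 0 1) volume := by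
    -- The squared singularity `|η|⁻²` is integrable near the origin since `2 < 3`.
    refine integrableOn_ball_of_norm_le_rpow (C := C ^ 2) (α := 2) (by simp) (by simp; norm_num)
      (ae_restrict_of_ae ?_) (hf.norm.pow 2)
    filter_upwards [hC] with η hη
    rw [Real.norm_of_nonneg (by positivity), Real.rpow_neg (norm_nonneg _), Real.rpow_ofNat]
    calc _ ≤ (C * ‖η‖⁻¹) ^ 2 := by gcongr
      _ = _ := by rw [mul_pow, inv_pow]
  have h2 : IntegrableOn (fun η : R3 => ‖f η‖ ^ 2) (Metric.ball 0 1)ᶜ volume := by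
    refine Integrable.mono' (g := fun η => ‖g η‖ ^ 2)
      ((memLp_two_iff_integrable_sq_norm hg.1).1 hg).integrableOn
      (hf.norm.pow 2).restrict ?_
    rw [ae_restrict_iff' measurableSet_ball.compl]
    filter_upwards [h] with η hη hb
    rw [Real.norm_of_nonneg (by positivity)]
    have : 1 ≤ ‖η‖ := by simpa using hb
    have := hη this
    gcongr
  have := h1.union h2
  rwa [Set.union_compl_self, integrableOn_univ] at this

/-- A symbol of tempered growth maps Schwartz functions to Schwartz functions. -/
lemma exists_isMultiplier_symbNegLap (φ : SchwartzMap R3 ℂ) :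
    ∃ v, IsMultiplier symbNegLap (φ.toLp 2 : L2) v := by
  refine isMultiplier_of_memLp (Lp.memLp _) ?_
  rw [Lp.toLp_coeFn, SchwartzMap.toLp_fourier_eq]
  have hg : Function.HasTemperateGrowth symbNegLap := by
    have : symbNegLap = fun η : R3 => (((2 * Real.pi) ^ 2 * ‖η‖ ^ 2 : ℝ) : ℂ) := by
      funext η; simp [symbNegLap]; ring
    rw [this]
    fun_prop
  refine (memLp_congr_ae ?_).1
    ((SchwartzMap.smulLeftCLM ℂ symbNegLap (𝓕 φ)).memLp 2 volume)
  filter_upwards [(𝓕 φ).coeFn_toLp 2 volume] with η hη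
  rw [hη, SchwartzMap.smulLeftCLM_apply_apply hg, smul_eq_mul]

section Density

variable {σ : R3 → ℝ}

lemma integrable_translate (h : Integrable σ volume) (n : Z3) :
    Integrable (fun x => (σ (x - latt n) : ℂ)) volume :=
  (h.comp_sub_right (latt n)).ofReal

lemma memLp_translate (h : MemLp σ 2 volume) (n : Z3) :
    MemLp (fun x => (σ (x - latt n) : ℂ)) 2 volume :=
  (h.comp_measurePreserving (measurePreserving_sub_right volume (latt n))).ofReal

/-- `G∂ₖσ(·-n)` is well defined. -/
lemma exists_isMultiplier_symbG_mul_symbPartial (h1 : Integrable σ volume) (h2 : MemLp σ 2 volume)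
    (n : Z3) (k : Fin 3) : ∃ v, IsMultiplier (fun η => symbG η * symbPartial k η)
      (fun x => (σ (x - latt n) : ℂ)) v := by
  refine isMultiplier_of_memLp (memLp_translate h2 n) ?_
  have hm : Measurable fun η => symbG η * symbPartial k η :=
    measurable_symbG.mul (measurable_symbPartial k)
  -- Near the origin the transform is bounded by the `L¹` norm of `σ`, leaving `|η|⁻¹`; for `|η| ≥
  -- 1` the symbol is at most `1` and Plancherel suffices.
  refine memLp_two_of_le_inv_norm (C := ∫ x, ‖(σ (x - latt n) : ℂ)‖)
    (hm.aestronglyMeasurable.mul (Lp.aestronglyMeasurable _)) ?_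
    (Lp.memLp (𝓕 ((memLp_translate h2 n).toLp _) : L2)) (Filter.Eventually.of_forall fun η hη => ?_)
  · filter_upwards [fourier_toLp_ae_eq (integrable_translate h1 n) (memLp_translate h2 n)] with η hη
    rw [hη, norm_mul, mul_comm]
    gcongr
    · exact norm_fourier_le_integral_norm _ _
    · exact norm_symbG_mul_symbPartial_le k η
  · rw [norm_mul]
    exact mul_le_of_le_one_left (norm_nonneg _)
      ((norm_symbG_mul_symbPartial_le k η).trans (inv_le_one_of_one_le₀ hη))

lemma memLp_bounded_mul {a : R3 → ℂ} (ha : Measurable a) {C : ℝ} (hC : ∀ η, ‖a η‖ ≤ C)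
    {g : R3 → ℂ} (hg : MemLp g 2 volume) : MemLp (fun η => a η * g η) 2 volume :=
  hg.of_le_mul (c := C) (ha.aestronglyMeasurable.mul hg.1) (Filter.Eventually.of_forall fun η => by
    rw [norm_mul]; gcongr; exact hC η)

/-- `G∂ⱼ∂ₖσ(·-n)` is well defined. -/
lemma exists_isMultiplier_symbG_mul_symbPartial_mul_symbPartial (h2 : MemLp σ 2 volume)
    (n : Z3) (j k : Fin 3) : ∃ v, IsMultiplier (fun η => symbG η * symbPartial j η * symbPartial k η)
      (fun x => (σ (x - latt n) : ℂ)) v :=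
  isMultiplier_of_memLp (memLp_translate h2 n) (memLp_bounded_mul
    ((measurable_symbG.mul (measurable_symbPartial j)).mul (measurable_symbPartial k))
    (norm_symbG_mul_symbPartial_mul_symbPartial_le j k) (Lp.memLp _))

end Density

/-! ### Periodic functions of class `H²` -/

/-- The half-open unit cube in coordinates. -/
abbrev unitCube : Set (Fin 3 → ℝ) := {x | ∀ i, x i ∈ Set.Ioc (0 : ℝ) (0 + 1)}

lemma measurableSet_unitCube : MeasurableSet unitCube :=
  MeasurableSet.univ_pi' (fun _ => measurableSet_Ioc)

section Torus

local instance : MeasureSpace UnitAddCircle := ⟨AddCircle.haarAddCircle⟩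

local instance : Measure.IsAddHaarMeasure (volume : Measure UnitAddCircle) :=
  inferInstanceAs (Measure.IsAddHaarMeasure AddCircle.haarAddCircle)

local instance : IsProbabilityMeasure (volume : Measure UnitAddCircle) :=
  inferInstanceAs (IsProbabilityMeasure AddCircle.haarAddCircle)

/-- A function on `ℝ³`, restricted to the unit cube, as a function on the torus. -/
def torusLift (f : (Fin 3 → ℝ) → ℂ) (t : UnitAddTorus (Fin 3)) : ℂ :=
  f (UnitAddTorus.measurableEquivPiIoc (fun _ => (0 : ℝ)) t).1

lemma torusLift_coe (f : (Fin 3 → ℝ) → ℂ) {x : Fin 3 → ℝ} (hx : x ∈ unitCube) :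
    torusLift f (fun i => (x i : UnitAddCircle)) = f x := by
  have := (UnitAddTorus.measurableEquivPiIoc (fun _ : Fin 3 => (0 : ℝ))).apply_symm_apply ⟨x, hx⟩
  rw [UnitAddTorus.coe_symm_measurableEquivPiIoc_apply] at this
  rw [torusLift, this]

lemma mFourier_coe (m : Z3) (x : Fin 3 → ℝ) :
    UnitAddTorus.mFourier m (fun i => (x i : UnitAddCircle)) =
      Complex.exp (2 * Real.pi * Complex.I * ((∑ k, m k * x k : ℝ) : ℂ)) := by
  simp only [UnitAddTorus.mFourier, ContinuousMap.coe_mk, fourier_coe_apply]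
  rw [← Complex.exp_sum]
  congr 1
  push_cast
  rw [Finset.mul_sum]
  exact Finset.sum_congr rfl fun k _ => by ring

/-- A square integrable function on the unit cube with absolutely summable Fourier coefficients is
almost everywhere the sum of its Fourier series. -/
lemma ae_eq_tsum_exp_unitCube {f : (Fin 3 → ℝ) → ℂ} (hf : MemLp f 2 (volume.restrict unitCube))
    {c : Z3 → ℂ} (hc : ∀ m, c m = ∫ x in unitCube,
      Complex.exp (2 * Real.pi * Complex.I * ((∑ k, m k * x k : ℝ) : ℂ)) * f x)
    (hs : Summable fun m => ‖c m‖) :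
    ∀ᵐ x ∂(volume.restrict unitCube), f x =
      ∑' m, c m * Complex.exp (-(2 * Real.pi * Complex.I * ((∑ k, m k * x k : ℝ) : ℂ))) := by
  set e := UnitAddTorus.measurableEquivPiIoc (fun _ : Fin 3 => (0 : ℝ)) with he
  have hmp : MeasurePreserving e volume (Measure.comap Subtype.val volume) :=
    UnitAddTorus.measurePreserving_equivPiIoc (fun _ : Fin 3 => (0 : ℝ))
  have hL : MemLp (torusLift f) 2 volume :=
    hf.comp_measurePreserving ((measurePreserving_subtype_coe measurableSet_unitCube).comp hmp)
  set F := hL.toLp (torusLift f) with hF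
  -- The coefficients `c` are taken against `e^{+2πi m·x}`, the opposite sign to `mFourierCoeff`;
  -- hence the reflected index.
  have hcoef : ∀ n, UnitAddTorus.mFourierCoeff F n = c (-n) := fun n => by
    have h1 : UnitAddTorus.mFourierCoeff F n = UnitAddTorus.mFourierCoeff (torusLift f) n :=
      integral_congr_ae (by filter_upwards [hL.coeFn_toLp] with t ht; rw [ht])
    rw [h1, UnitAddTorus.mFourierCoeff_eq_integral _ _ (fun _ => (0 : ℝ)), hc]
    refine setIntegral_congr_fun measurableSet_unitCube fun x hx => ?_
    simp only [smul_eq_mul]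
    rw [torusLift_coe f hx, mFourier_coe]
  have hsum : Summable fun n : Z3 => c (-n) • UnitAddTorus.mFourier n := by
    refine .of_norm ?_
    simp only [norm_smul, UnitAddTorus.mFourier_norm, mul_one]
    exact hs.comp_injective neg_injective
  -- The series converges to `F` in `L²` and also uniformly, by absolute summability; the two limits
  -- agree.
  have hFh : F = ContinuousMap.toLp (E := ℂ) 2 volume ℂ
      (∑' n : Z3, c (-n) • UnitAddTorus.mFourier n) := by
    refine (UnitAddTorus.hasSum_mFourier_series_L2 F).unique ?_
    have := hsum.hasSum.mapL (ContinuousMap.toLp (E := ℂ) 2 volume ℂ)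
    simpa only [hcoef, map_smul] using this
  have hae : ∀ᵐ t, torusLift f t =
      (∑' n : Z3, c (-n) • UnitAddTorus.mFourier n : C(UnitAddTorus (Fin 3), ℂ)) t := by
    have h1 := hL.coeFn_toLp
    rw [← hF, hFh] at h1
    exact h1.symm.trans (ContinuousMap.coeFn_toLp volume _)
  have hpull := hmp.symm.quasiMeasurePreserving.ae hae
  rw [ae_restrict_iff_subtype measurableSet_unitCube]
  refine Filter.Eventually.mono hpull fun x hx => ?_
  rw [he, UnitAddTorus.coe_symm_measurableEquivPiIoc_apply, torusLift_coe f x.2] at hx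
  rw [hx, ← (ContinuousMap.hasSum_apply hsum.hasSum _).tsum_eq, ← (Equiv.neg Z3).tsum_eq]
  refine tsum_congr fun n => ?_
  simp only [ContinuousMap.coe_smul, Pi.smul_apply, smul_eq_mul, Equiv.neg_apply]
  rw [mFourier_coe, neg_neg, ← mul_neg, ← Complex.ofReal_neg, ← Finset.sum_neg_distrib]
  simp

end Torus

lemma inner_latt (m : Z3) (x : R3) : inner ℝ (latt m) x = ∑ k, (m k : ℝ) * x k := by
  simp [PiLp.inner_apply, latt_apply, mul_comm]

/-- The closed and half-open cubes differ only on the null faces `x k = 0`. -/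
lemma cell_ae_eq_unitCube :
    cell =ᵐ[volume] (MeasurableEquiv.toLp 2 (Fin 3 → ℝ)).symm ⁻¹' unitCube := by
  have h := (EuclideanSpace.volume_preserving_symm_measurableEquiv_toLp (Fin 3)).quasiMeasurePreserving
  have hk : ∀ k : Fin 3, ∀ᵐ x : Fin 3 → ℝ, x k ≠ 0 := fun k => by
    have := Measure.ae_eval_ne (μ := fun _ : Fin 3 => (volume : Measure ℝ)) k 0
    exact this
  have hk' := h.ae (ae_all_iff.2 hk)
  filter_upwards [hk'] with x hx
  apply propext
  change (∀ k, 0 ≤ x k ∧ x k ≤ 1) ↔ ∀ k, x k ∈ Set.Ioc (0 : ℝ) (0 + 1)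
  refine forall_congr' fun k => ?_
  have h0 : x k ≠ 0 := hx k
  simp only [zero_add, Set.mem_Ioc]
  exact ⟨fun ⟨h1, h2⟩ => ⟨lt_of_le_of_ne h1 h0.symm, h2⟩, fun ⟨h1, h2⟩ => ⟨h1.le, h2⟩⟩

lemma measurePreserving_cell :
    MeasurePreserving (MeasurableEquiv.toLp 2 (Fin 3 → ℝ)).symm
      (volume.restrict cell) (volume.restrict unitCube) := by
  rw [Measure.restrict_congr_set cell_ae_eq_unitCube]
  exact (EuclideanSpace.volume_preserving_symm_measurableEquiv_toLp (Fin 3)).restrict_preimage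
    measurableSet_unitCube

/-- A property of the points of `ℝ³` invariant under the lattice that holds almost everywhere on the
cell holds almost everywhere. -/
lemma ae_of_ae_cell {p : R3 → Prop} (hp : ∀ (n : Z3) (x : R3), p (x + latt n) → p x)
    (h : ∀ᵐ x ∂(volume.restrict cell), p x) : ∀ᵐ x, p x := by
  rw [Measure.restrict_congr_set cell_ae_eq_unitCube, ae_restrict_iff'
    ((MeasurableEquiv.toLp 2 (Fin 3 → ℝ)).symm.measurable measurableSet_unitCube)] at h
  have h1 : ∀ n : Z3, ∀ᵐ x : R3, x + latt n ∈ (MeasurableEquiv.toLp 2 (Fin 3 → ℝ)).symm ⁻¹' unitCube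
      → p (x + latt n) := fun n =>
    (measurePreserving_add_right volume (latt n)).quasiMeasurePreserving.ae h
  filter_upwards [ae_all_iff.2 h1] with x hx
  -- This is the translation carrying `x` into the half-open cube, as `x k - ⌈x k⌉ ∈ (-1, 0]`.
  set n : Z3 := fun k => 1 - ⌈x k⌉ with hn
  refine hp n x (hx n ?_)
  change ∀ k, (x + latt n) k ∈ Set.Ioc (0 : ℝ) (0 + 1)
  intro k
  simp only [PiLp.add_apply, latt_apply, hn, zero_add, Set.mem_Ioc]
  push_cast
  constructor <;> linarith [Int.ceil_lt_add_one (x k), Int.le_ceil (x k)]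

/-- A function of class `H²(T³)` is almost everywhere the sum of an absolutely convergent Fourier
series. -/
lemma MemH2Per.exists_fourier_series {f : R3 → ℝ} (hf : MemH2Per f) :
    ∃ c : Z3 → ℂ, (Summable fun m => ‖c m‖) ∧
      ∀ᵐ x, (f x : ℂ) = ∑' m, c m * Complex.exp (-(2 * Real.pi * Complex.I *
        (inner ℝ (latt m) x : ℝ))) := by
  have hs : Summable fun m => ‖perCoeff f m‖ := by
    refine Summable.of_nonneg_of_le (fun m => norm_nonneg _) (fun m => ?_)
      (hf.summable.add summable_lattice_weight)
    set a := (1 + ‖latt m‖ ^ 2) with ha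
    have ha0 : 0 < a := by positivity
    -- Expanding gives `2‖c‖ ≤ a²‖c‖² + a⁻²`: the first term is summable by `H²` regularity, the
    -- second by the lattice sum.
    have h1 : 0 ≤ (a * ‖perCoeff f m‖ - a⁻¹) ^ 2 := sq_nonneg _
    have h2 : (a * ‖perCoeff f m‖ - a⁻¹) ^ 2 =
        a ^ 2 * ‖perCoeff f m‖ ^ 2 + (a ^ 2)⁻¹ - 2 * ‖perCoeff f m‖ := by
      field_simp; ring
    nlinarith [norm_nonneg (perCoeff f m)]
  refine ⟨perCoeff f, hs, ?_⟩
  have hmp := measurePreserving_cell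
  have hper : ∀ (n m : Z3) (x : R3),
      Complex.exp (-(2 * Real.pi * Complex.I * (inner ℝ (latt m) (x + latt n) : ℝ))) =
      Complex.exp (-(2 * Real.pi * Complex.I * (inner ℝ (latt m) x : ℝ))) := fun n m x => by
    rw [Complex.exp_eq_exp_iff_exists_int]
    refine ⟨-∑ k, m k * n k, ?_⟩
    rw [inner_add_right, inner_latt m (latt n)]
    push_cast
    simp only [latt_apply, Complex.ofReal_intCast]
    ring
  refine ae_of_ae_cell (fun n x h => ?_) ?_
  · simpa only [hf.periodic, hper] using h
  have hm2 : MemLp (fun y : Fin 3 → ℝ => (f (WithLp.toLp 2 y) : ℂ)) 2 (volume.restrict unitCube) := by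
    have := hmp.symm
    exact (hf.memLp.comp_measurePreserving this).ofReal
  have hser := ae_eq_tsum_exp_unitCube (c := perCoeff f) hm2 (fun m => ?_) hs
  · have := hmp.quasiMeasurePreserving.ae hser
    filter_upwards [this] with x hx
    simp only [inner_latt]
    exact hx
  · rw [perCoeff]
    have := hmp.integral_comp (MeasurableEquiv.measurableEmbedding _)
      (g := fun y : Fin 3 → ℝ => Complex.exp (2 * Real.pi * Complex.I *
        ((∑ k, m k * y k : ℝ) : ℂ)) * (f (WithLp.toLp 2 y) : ℂ))
    rw [← this]
    simp only [inner_latt]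
    rfl

lemma norm_exp_neg_two_pi_I (t : ℝ) :
    ‖Complex.exp (-(2 * Real.pi * Complex.I * (t : ℂ)))‖ = 1 := by
  rw [Complex.norm_exp]; simp

/-- The Sobolev embedding `H² ⊂ L^∞` in dimension three: the sum of the moduli of the Fourier
coefficients is a bound. -/
lemma MemH2Per.exists_bound {f : R3 → ℝ} (hf : MemH2Per f) :
    ∃ C : ℝ, 0 ≤ C ∧ ∀ᵐ x, |f x| ≤ C := by
  obtain ⟨c, hs, hc⟩ := hf.exists_fourier_series
  refine ⟨∑' m, ‖c m‖, tsum_nonneg fun m => norm_nonneg _, ?_⟩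
  filter_upwards [hc] with x hx
  rw [← Real.norm_eq_abs, ← Complex.norm_real, hx]
  refine tsum_of_norm_bounded hs.hasSum fun m => ?_
  rw [norm_mul, norm_exp_neg_two_pi_I, mul_one]

/-- `MemH2Per` records measurability on the cell only; the Fourier series provides a continuous
representative on all of `ℝ³`. -/
lemma MemH2Per.aestronglyMeasurable {f : R3 → ℝ} (hf : MemH2Per f) :
    AEStronglyMeasurable f volume := by
  obtain ⟨c, hs, hc⟩ := hf.exists_fourier_series
  have h : Continuous fun x : R3 => ∑' m, c m * Complex.exp (-(2 * Real.pi * Complex.I *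
      (inner ℝ (latt m) x : ℝ))) :=
    continuous_tsum (fun m => by fun_prop) hs fun m x => by
      rw [norm_mul, norm_exp_neg_two_pi_I, mul_one]
  exact (Complex.continuous_re.comp_aestronglyMeasurable h.aestronglyMeasurable).congr
    (by filter_upwards [hc] with x hx; rw [← hx, Complex.ofReal_re])

lemma MemH2Per.memLp_mul {f : R3 → ℝ} (hf : MemH2Per f) {g : R3 → ℂ} (hg : MemLp g 2 volume) :
    MemLp (fun x => (f x : ℂ) * g x) 2 volume := by
  obtain ⟨C, -, hC⟩ := hf.exists_bound
  refine hg.of_le_mul (c := C) ((Complex.continuous_ofReal.comp_aestronglyMeasurable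
    hf.aestronglyMeasurable).mul hg.1) ?_
  filter_upwards [hC] with x hx
  rw [norm_mul, Complex.norm_real]
  gcongr
  exact hx

lemma MemH2Per.integrable_mul {f : R3 → ℝ} (hf : MemH2Per f) {g : R3 → ℂ}
    (hg : Integrable g volume) : Integrable (fun x => (f x : ℂ) * g x) volume := by
  obtain ⟨C, -, hC⟩ := hf.exists_bound
  refine hg.bdd_mul (c := C) (Complex.continuous_ofReal.comp_aestronglyMeasurable
    hf.aestronglyMeasurable) ?_
  filter_upwards [hC] with x hx
  rwa [Complex.norm_real]

/-- The Fourier transform of a periodic function times `φ` is a superposition of lattice translates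
of the Fourier transform of `φ`. -/
lemma MemH2Per.fourier_mul_eq_zero {f : R3 → ℝ} (hf : MemH2Per f) (φ : SchwartzMap R3 ℂ) {η : R3}
    (h : ∀ m : Z3, (𝓕 φ : SchwartzMap R3 ℂ) (η + latt m) = 0) :
    𝓕 (fun x => (f x : ℂ) * φ x) η = 0 := by
  obtain ⟨c, hs, hc⟩ := hf.exists_fourier_series
  set F : Z3 → R3 → ℂ := fun m x =>
    c m * (Real.fourierChar (-inner ℝ x (η + latt m)) • φ x) with hF
  have hφ : Integrable φ volume := φ.integrable
  have hFi : ∀ m, Integrable (F m) volume := fun m =>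
    ((Real.fourierIntegral_convergent_iff (η + latt m)).2 hφ).const_mul (c m)
  have hFn : ∀ m, ∫ x, ‖F m x‖ = ‖c m‖ * ∫ x, ‖φ x‖ := fun m => by
    simp only [hF, norm_mul, Circle.norm_smul]
    rw [integral_const_mul]
  have hsum := hasSum_integral_of_summable_integral_norm hFi
    (by simp only [hFn]; exact hs.mul_right _)
  -- The `m`-th term integrates to `c m` times the transform of `φ` at `η + latt m`.
  have hz : ∀ m, ∫ x, F m x = 0 := fun m => by
    simp only [hF]
    rw [integral_const_mul, ← Real.fourier_eq, ← SchwartzMap.fourier_coe, h m, mul_zero]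
  simp only [hz] at hsum
  have h0 : ∫ x, ∑' m, F m x = 0 := hsum.unique hasSum_zero
  rw [Real.fourier_eq, ← h0]
  refine integral_congr_ae ?_
  filter_upwards [hc] with x hx
  rw [hx, Circle.smul_def, smul_eq_mul, ← tsum_mul_right, ← tsum_mul_left]
  refine tsum_congr fun m => ?_
  simp only [hF, Circle.smul_def, smul_eq_mul, Real.fourierChar_apply]
  have : Complex.exp (((2 * Real.pi * -inner ℝ x (η + latt m) : ℝ) : ℂ) * Complex.I) =
      Complex.exp (((2 * Real.pi * -inner ℝ x η : ℝ) : ℂ) * Complex.I) *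
      Complex.exp (-(2 * Real.pi * Complex.I * (inner ℝ (latt m) x : ℝ))) := by
    rw [← Complex.exp_add, inner_add_right, real_inner_comm (latt m) x]
    congr 1
    push_cast
    ring
  rw [this]
  ring

/-- The Fourier transform of a periodic function times an element of `𝒮₊` vanishes near the origin. -/
lemma MemH2Per.exists_fourier_mul_eq_zero {f : R3 → ℝ} (hf : MemH2Per f) {φ : SchwartzMap R3 ℂ}
    (h : φ ∈ schwartzPlus) :
    ∃ δ > 0, ∀ η : R3, ‖η‖ < δ → 𝓕 (fun x => (f x : ℂ) * φ x) η = 0 := by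
  obtain ⟨ε, hε, h⟩ := h
  have hpi : 0 < 2 * Real.pi := by positivity
  refine ⟨ε / (2 * Real.pi), by positivity, fun η hη => hf.fourier_mul_eq_zero φ fun m => ?_⟩
  -- The set `schwartzPlus` is written in the variable `ξ = -2πη`, which accounts for the reflection
  -- of `m` and the radius `ε / 2π`.
  have := h (-((2 * Real.pi) • (η + latt m))) (-m) ?_
  · rwa [smul_neg, neg_neg, inv_smul_smul₀ hpi.ne'] at this
  · rw [dist_eq_norm, latt_neg, smul_neg, sub_neg_eq_add, smul_add, neg_add, neg_add_cancel_right,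
      norm_neg, norm_smul, Real.norm_of_nonneg hpi.le]
    rwa [lt_div_iff₀' hpi] at hη

/-! ### Density of the domain -/

/-- The classes in `L²(ℝ³)` of the functions of `𝒮₊`. -/
def schwartzPlusL2 : Submodule ℂ L2 where
  carrier := {u | ∃ φ ∈ schwartzPlus, u = φ.toLp 2}
  zero_mem' := by
    refine ⟨0, ⟨1, one_pos, fun ξ m _ => ?_⟩, ?_⟩
    · rw [show (𝓕 (0 : SchwartzMap R3 ℂ) : SchwartzMap R3 ℂ) = 0 from
        (FourierTransform.fourierCLM ℂ (SchwartzMap R3 ℂ)).map_zero]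
      rfl
    · exact ((SchwartzMap.toLpCLM ℂ ℂ 2 volume).map_zero).symm
  add_mem' := by
    rintro _ _ ⟨φ, ⟨ε, hε, hφ⟩, rfl⟩ ⟨χ, ⟨δ, hδ, hχ⟩, rfl⟩
    refine ⟨φ + χ, ⟨min ε δ, lt_min hε hδ, fun ξ m h => ?_⟩, ?_⟩
    · rw [FourierTransform.fourier_add, add_apply, hφ ξ m (h.trans_le (min_le_left _ _)),
        hχ ξ m (h.trans_le (min_le_right _ _)), add_zero]
    · exact ((SchwartzMap.toLpCLM ℂ ℂ 2 volume).map_add φ χ).symm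
  smul_mem' := by
    rintro c _ ⟨φ, ⟨ε, hε, hφ⟩, rfl⟩
    refine ⟨c • φ, ⟨ε, hε, fun ξ m h => ?_⟩, ?_⟩
    · rw [FourierTransform.fourier_smul, smul_apply, hφ ξ m h, smul_zero]
    · exact ((SchwartzMap.toLpCLM ℂ ℂ 2 volume).map_smul c φ).symm

lemma isClosed_range_latt : IsClosed (Set.range latt) := by
  have : Set.range latt = ⋂ k : Fin 3, (fun x : R3 => x k) ⁻¹' Set.range (Int.cast : ℤ → ℝ) := by
    ext x
    simp only [Set.mem_range, Set.mem_iInter, Set.mem_preimage]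
    constructor
    · rintro ⟨m, rfl⟩ k
      exact ⟨m k, rfl⟩
    · intro h
      choose m hm using h
      exact ⟨m, by ext k; exact hm k⟩
  rw [this]
  exact isClosed_iInter fun k =>
    Int.isClosedEmbedding_coe_real.isClosed_range.preimage (by fun_prop)

/-- A test function supported away from the lattice is the Fourier transform of an element of
`𝒮₊`. -/
lemma fourierInv_mem_schwartzPlus {φ : SchwartzMap R3 ℂ} (hc : HasCompactSupport φ)
    (hs : tsupport φ ⊆ (Set.range latt)ᶜ) : 𝓕⁻ φ ∈ schwartzPlus := by
  obtain ⟨δ, hδ, hsub⟩ := IsCompact.exists_thickening_subset_open hc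
    isClosed_range_latt.isOpen_compl hs
  have hpi : 0 < 2 * Real.pi := by positivity
  refine ⟨2 * Real.pi * δ, by positivity, fun ξ m h => ?_⟩
  rw [FourierTransform.fourier_fourierInv_eq]
  by_contra h0
  have h1 : -((2 * Real.pi)⁻¹ • ξ) ∈ tsupport φ := subset_tsupport _ h0
  have h2 : latt (-m) ∈ Metric.thickening δ (tsupport φ) := by
    rw [Metric.mem_thickening_iff]
    refine ⟨_, h1, ?_⟩
    rw [latt_neg, dist_neg_neg, dist_comm]
    have : latt m = (2 * Real.pi)⁻¹ • ((2 * Real.pi) • latt m) := by rw [inv_smul_smul₀ hpi.ne']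
    rw [this, dist_smul₀, Real.norm_of_nonneg (by positivity), inv_mul_lt_iff₀ hpi]
    exact h
  exact hsub h2 ⟨-m, rfl⟩

lemma mem_schwartzPlusL2 {φ : SchwartzMap R3 ℂ} (h : φ ∈ schwartzPlus) :
    φ.toLp 2 volume ∈ schwartzPlusL2 :=
  ⟨φ, h, rfl⟩

lemma inner_toLp_fourierInv (φ : SchwartzMap R3 ℂ) (u : L2) :
    inner ℂ ((𝓕⁻ φ).toLp 2 volume) u =
      ∫ x, (starRingEnd ℂ) (φ x) * (𝓕 u : L2) x := by
  rw [← Lp.inner_fourier_eq, SchwartzMap.toLp_fourier_eq,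
    FourierTransform.fourier_fourierInv_eq, L2.inner_def]
  refine integral_congr_ae ?_
  filter_upwards [φ.coeFn_toLp 2 volume] with x hx
  rw [hx, RCLike.inner_apply, mul_comm]

/-- By Plancherel, orthogonality to `𝒮₊` says that `𝓕 u` annihilates every test function supported
off the closed set of lattice points. -/
lemma fourier_ae_eq_zero_of_mem_orthogonal {u : L2} (hu : u ∈ schwartzPlusL2ᗮ) :
    ∀ᵐ x, x ∈ (Set.range latt)ᶜ → (𝓕 u : L2) x = 0 := by
  have hl : LocallyIntegrable (𝓕 u : L2) volume :=
    (Lp.memLp (𝓕 u : L2)).locallyIntegrable (by norm_num)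
  refine isClosed_range_latt.isOpen_compl.ae_eq_zero_of_integral_contDiff_smul_eq_zero
    (hl.locallyIntegrableOn _) fun g hg hgc hgs => ?_
  have hgC : ContDiff ℝ ∞ fun x => (g x : ℂ) := Complex.ofRealCLM.contDiff.comp hg
  have hgcC : HasCompactSupport fun x => (g x : ℂ) := hgc.comp_left (g := Complex.ofReal) rfl
  have hts : tsupport (hgcC.toSchwartzMap hgC) ⊆ (Set.range latt)ᶜ := by
    refine subset_trans (closure_mono fun x hx => ?_) hgs
    have : (g x : ℂ) ≠ 0 := hx
    simpa using this
  have hin := (Submodule.mem_orthogonal _ _).1 hu _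
    (mem_schwartzPlusL2 (fourierInv_mem_schwartzPlus hgcC hts))
  rw [inner_toLp_fourierInv] at hin
  rw [← hin]
  refine integral_congr_ae (Filter.Eventually.of_forall fun x => ?_)
  change g x • (𝓕 u : L2) x = (starRingEnd ℂ) (g x : ℂ) * (𝓕 u : L2) x
  rw [Complex.conj_ofReal, Complex.real_smul]

/-- A function orthogonal to the subspace has its transform concentrated on a countable, hence null,
set. -/
lemma dense_schwartzPlusL2 : Dense (schwartzPlusL2 : Set L2) := by
  rw [Submodule.dense_iff_topologicalClosure_eq_top, Submodule.topologicalClosure_eq_top_iff,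
    Submodule.eq_bot_iff]
  intro u hu
  have hnull : volume (Set.range latt) = 0 := (Set.countable_range latt).measure_zero _
  have hz : (𝓕 u : L2) = 0 := by
    refine Lp.ext ?_
    filter_upwards [fourier_ae_eq_zero_of_mem_orthogonal hu,
      Lp.coeFn_zero ℂ 2 (volume : Measure R3),
      measure_eq_zero_iff_ae_notMem.1 hnull] with x h1 h2 h3
    rw [h1 h3, h2]
    rfl
  exact (map_eq_zero_iff _ (Lp.fourierTransformₗᵢ R3 ℂ).injective).1 hz

lemma dense_seqFin : Dense seqFin := by
  intro Q
  refine mem_closure_of_tendsto (lp.hasSum_single (by norm_num) Q)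
    (Filter.Eventually.of_forall fun s => ?_)
  obtain ⟨R, hR⟩ := exists_nat_ge (∑ n ∈ s, ‖latt n‖)
  refine ⟨R, fun n hn => ?_⟩
  have hns : n ∉ s := fun h => by
    have := Finset.single_le_sum (f := fun n => ‖latt n‖) (fun i _ => norm_nonneg _) h
    linarith
  rw [lp.coeFn_sum, Finset.sum_apply]
  refine Finset.sum_eq_zero fun i hi => ?_
  rw [lp.single_apply, Pi.single_eq_of_ne]
  rintro rfl
  exact hns hi

lemma dense_withLp_prod {E F : Type*} [NormedAddCommGroup E] [NormedAddCommGroup F]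
    {s : Set E} {t : Set F} (hs : Dense s) (ht : Dense t) :
    Dense {x : WithLp 2 (E × F) | x.fst ∈ s ∧ x.snd ∈ t} :=
  (hs.prod ht).preimage (WithLp.homeomorphProd 2 E F).isOpenMap

lemma dense_core : Dense core :=
  dense_withLp_prod dense_schwartzPlusL2
    (dense_withLp_prod dense_schwartzPlusL2 (dense_withLp_prod dense_seqFin dense_seqFin))

/-! ### The energy operator is well defined on the domain -/

lemma IsMultiplier.congr {a f g : R3 → ℂ} {v : L2} (h : IsMultiplier a f v)
    (hfg : f =ᵐ[volume] g) : IsMultiplier a g v := by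
  obtain ⟨u, hu, hv⟩ := h
  exact ⟨u, hu.trans hfg, hv⟩

lemma inner_L2_eq_integral (u v : L2) : inner ℂ u v = ∫ x, (starRingEnd ℂ) (u x) * v x := by
  rw [L2.inner_def]
  exact integral_congr_ae (Filter.Eventually.of_forall fun x => by
    simp only [RCLike.inner_apply, mul_comm])

lemma inner_L2_eq_integral_fourier (u v : L2) :
    inner ℂ u v = ∫ x, (starRingEnd ℂ) ((𝓕 u : L2) x) * (𝓕 v : L2) x := by
  rw [← Lp.inner_fourier_eq, inner_L2_eq_integral]

/-- The adjoint of a Fourier multiplier has the conjugate symbol. -/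
lemma IsMultiplier.integral_conj_mul {a f g : R3 → ℂ} {v w : L2} (hv : IsMultiplier a f v)
    (hw : IsMultiplier (fun η => (starRingEnd ℂ) (a η)) g w) :
    ∫ x, (starRingEnd ℂ) (v x) * g x = ∫ x, (starRingEnd ℂ) (f x) * w x := by
  have hf := hv.memLp
  have hg := hw.memLp
  have h1 : ∫ x, (starRingEnd ℂ) (v x) * g x = inner ℂ v (hg.toLp g) := by
    rw [inner_L2_eq_integral]
    refine integral_congr_ae ?_
    filter_upwards [hg.coeFn_toLp] with x hx
    rw [hx]
  have h2 : ∫ x, (starRingEnd ℂ) (f x) * w x = inner ℂ (hf.toLp f) w := by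
    rw [inner_L2_eq_integral]
    refine integral_congr_ae ?_
    filter_upwards [hf.coeFn_toLp] with x hx
    rw [hx]
  rw [h1, h2, inner_L2_eq_integral_fourier, inner_L2_eq_integral_fourier]
  refine integral_congr_ae ?_
  filter_upwards [hv.fourier_ae_eq hf, hw.fourier_ae_eq hg] with η h3 h4
  rw [h3, h4, map_mul]
  ring

/-- A multiplier with a symbol bounded away from the origin is defined on functions whose Fourier
transform vanishes near the origin. -/
lemma exists_isMultiplier_of_fourier_eq_zero {a : R3 → ℂ} (ha : Measurable a) {δ C : ℝ}
    (hC : ∀ η, δ ≤ ‖η‖ → ‖a η‖ ≤ C) {f : R3 → ℂ} (h1 : Integrable f volume)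
    (h2 : MemLp f 2 volume) (hz : ∀ η : R3, ‖η‖ < δ → 𝓕 f η = 0) : ∃ v, IsMultiplier a f v := by
  refine isMultiplier_of_memLp h2 ?_
  refine (Lp.memLp (𝓕 (h2.toLp f) : L2)).of_le_mul (c := C)
    (ha.aestronglyMeasurable.mul (Lp.aestronglyMeasurable _)) ?_
  filter_upwards [fourier_toLp_ae_eq h1 h2] with η hη
  rw [hη, norm_mul]
  by_cases hd : ‖η‖ < δ
  · simp [hz η hd]
  · gcongr
    exact hC η (not_lt.1 hd)

section Potential

variable {ψ : R3 → ℝ} {φ : SchwartzMap R3 ℂ}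

/-- The transform of `ψφ` vanishes near the origin, so a singularity of the symbol there is
invisible. This serves both `G` and the adjoint of `G∂ₖ`. -/
lemma exists_isMultiplier_periodic_mul (hψ : MemH2Per ψ) (hφ : φ ∈ schwartzPlus)
    {a : R3 → ℂ} (ha : Measurable a) (hC : ∀ δ > 0, ∃ C, ∀ η, δ ≤ ‖η‖ → ‖a η‖ ≤ C) :
    ∃ v, IsMultiplier a (fun x => (ψ x : ℂ) * (φ.toLp 2 volume : L2) x) v := by
  obtain ⟨δ, hδ, hz⟩ := hψ.exists_fourier_mul_eq_zero hφ
  obtain ⟨C, hC⟩ := hC δ hδ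
  obtain ⟨v, hv⟩ := exists_isMultiplier_of_fourier_eq_zero ha hC (hψ.integrable_mul φ.integrable)
    (hψ.memLp_mul (φ.memLp 2 volume)) hz
  refine ⟨v, hv.congr ?_⟩
  filter_upwards [φ.coeFn_toLp 2 volume] with x hx
  rw [hx]

lemma exists_isMultiplier_symbG_periodic_mul (hψ : MemH2Per ψ) (hφ : φ ∈ schwartzPlus) :
    ∃ v, IsMultiplier symbG (fun x => (ψ x : ℂ) * (φ.toLp 2 volume : L2) x) v := by
  refine exists_isMultiplier_periodic_mul hψ hφ measurable_symbG fun δ hδ =>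
    ⟨((2 * Real.pi * δ) ^ 2)⁻¹, fun η hη => ?_⟩
  rw [norm_symbG]
  have := Real.pi_pos
  gcongr

lemma exists_isMultiplier_conj_periodic_mul (hψ : MemH2Per ψ) (hφ : φ ∈ schwartzPlus)
    (k : Fin 3) : ∃ v, IsMultiplier (fun η => (starRingEnd ℂ) (symbG η * symbPartial k η))
      (fun x => (ψ x : ℂ) * (φ.toLp 2 volume : L2) x) v := by
  refine exists_isMultiplier_periodic_mul hψ hφ
    (Complex.continuous_conj.measurable.comp (measurable_symbG.mul (measurable_symbPartial k)))
    fun δ hδ => ⟨δ⁻¹, fun η hη => ?_⟩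
  rw [RCLike.norm_conj]
  exact (norm_symbG_mul_symbPartial_le k η).trans (by gcongr)

end Potential

/-! ### Finitely supported and square summable sequences. -/

lemma exists_finset_of_mem_seqFin {Q : SeqL2} (hQ : Q ∈ seqFin) :
    ∃ s : Finset Z3, ∀ n ∉ s, Q n = 0 := by
  obtain ⟨R, hR⟩ := hQ
  refine ⟨Finset.Icc (fun _ => -(R : ℤ)) (fun _ => (R : ℤ)), fun n hn => hR n ?_⟩
  by_contra h
  refine hn (Finset.mem_Icc.2 ?_)
  have : ∀ k, |n k| ≤ (R : ℤ) := fun k => by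
    have h1 := (PiLp.norm_apply_le (latt n) k).trans (not_lt.1 h)
    rw [latt_apply, Real.norm_eq_abs] at h1
    exact_mod_cast h1
  exact ⟨fun k => (abs_le.1 (this k)).1, fun k => (abs_le.1 (this k)).2⟩

lemma memℓp_two_iff {E : Type*} [NormedAddCommGroup E] {f : Z3 → E} :
    Memℓp (E := fun _ => E) f 2 ↔ Summable fun n => ‖f n‖ ^ 2 := by
  rw [memℓp_gen_iff (by norm_num)]
  simp

lemma memℓp_two_of_forall_coord {f : Z3 → EuclideanSpace ℂ (Fin 3)}
    (h : ∀ j, Summable fun n => ‖f n j‖ ^ 2) :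
    Memℓp (E := fun _ : Z3 => EuclideanSpace ℂ (Fin 3)) f 2 := by
  rw [memℓp_two_iff]
  simp only [EuclideanSpace.norm_sq_eq]
  exact summable_sum fun j _ => h j

lemma summable_sq_norm_add {f g : Z3 → ℂ} (hf : Summable fun n => ‖f n‖ ^ 2)
    (hg : Summable fun n => ‖g n‖ ^ 2) : Summable fun n => ‖f n + g n‖ ^ 2 := by
  refine Summable.of_nonneg_of_le (fun n => by positivity) (fun n => ?_)
    ((hf.add hg).mul_left 2)
  calc _ ≤ (‖f n‖ + ‖g n‖) ^ 2 := by gcongr; exact norm_add_le _ _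
    _ ≤ _ := by nlinarith [sq_nonneg (‖f n‖ - ‖g n‖)]

lemma summable_sq_norm_const_mul {f : Z3 → ℂ} (c : ℂ) (hf : Summable fun n => ‖f n‖ ^ 2) :
    Summable fun n => ‖c * f n‖ ^ 2 := by
  simp only [norm_mul, mul_pow]
  exact hf.mul_left _

lemma summable_sq_norm_sum {ι : Type*} (s : Finset ι) {f : ι → Z3 → ℂ}
    (hf : ∀ i, Summable fun n => ‖f i n‖ ^ 2) : Summable fun n => ‖∑ i ∈ s, f i n‖ ^ 2 := by
  classical
  induction s using Finset.induction_on with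
  | empty => simp
  | insert i s hi ih =>
    simp only [Finset.sum_insert hi]
    exact summable_sq_norm_add (hf i) ih

/-! ### Existence and uniqueness of `BY`. -/

section Hessian

variable {e M : ℝ} {σ ψ Φ : R3 → ℝ} {freq : ℝ}

/-- In a fixed column, the Coulomb part pairs one `L²` function with all translates of `σ`, and the
on-site part has a single nonzero entry. -/
lemma summable_sq_matT (hσ : MemLp (fun x => (1 + ‖x‖ ^ 2) * σ x) 2 (volume : Measure R3))
    (R : Z3 → Fin 3 → Fin 3 → L2) (n' : Z3) (j k : Fin 3) :
    Summable fun n => ‖matT σ Φ R n n' j k‖ ^ 2 := by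
  unfold matT
  refine summable_sq_norm_add ?_ ?_
  · simp only [norm_neg]
    exact summable_sq_integral_translates hσ (R n' j k)
  · refine summable_of_ne_finset_zero (s := {n'}) fun n hn => ?_
    rw [if_neg (by simpa using hn)]
    simp

/-- Moving the multiplier `G∂ⱼ` from `σ(·-n)` onto `ψφ` makes every integral a pairing of `σ(·-n)`
with one function `w ∈ L²` independent of `n`. -/
lemma summable_sq_coupling (hσ : MemLp (fun x => (1 + ‖x‖ ^ 2) * σ x) 2 (volume : Measure R3))
    (hψ : MemH2Per ψ) {φ : SchwartzMap R3 ℂ} (hφ : φ ∈ schwartzPlus) {K : Z3 → Fin 3 → L2}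
    (hK : ∀ n k, IsMultiplier (fun η => symbG η * symbPartial k η)
      (fun x => (σ (x - latt n) : ℂ)) (K n k)) (j : Fin 3) :
    Summable fun n => ‖∫ x, (starRingEnd ℂ) (e * ψ x * K n j x) *
      (φ.toLp 2 volume : L2) x‖ ^ 2 := by
  obtain ⟨w, hw⟩ := exists_isMultiplier_conj_periodic_mul hψ hφ j
  have : ∀ n, ∫ x, (starRingEnd ℂ) (e * ψ x * K n j x) * (φ.toLp 2 volume : L2) x =
      (e : ℂ) * ∫ x, w x * (σ (x - latt n) : ℂ) := fun n => by
    have h := (hK n j).integral_conj_mul hw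
    simp only [Complex.conj_ofReal] at h
    simp only [mul_comm (w _)]
    rw [← h, ← integral_const_mul]
    refine integral_congr_ae (Filter.Eventually.of_forall fun x => ?_)
    simp only [map_mul, Complex.conj_ofReal]
    ring
  simp only [this]
  exact summable_sq_norm_const_mul _ (summable_sq_integral_translates hσ w)

lemma Phase.eq_of_components {V W : Phase} (h1 : V.psi1 = W.psi1) (h2 : V.psi2 = W.psi2)
    (h3 : V.posn = W.posn) (h4 : V.mom = W.mom) : V = W :=
  WithLp.ofLp_injective _ (Prod.ext h1 (WithLp.ofLp_injective _ (Prod.ext h2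
    (WithLp.ofLp_injective _ (Prod.ext h3 h4)))))

lemma IsHessian.unique {Y V W : Phase} (hV : IsHessian e M σ ψ Φ freq Y V)
    (hW : IsHessian e M σ ψ Φ freq Y W) : V = W := by
  obtain ⟨D₁, D₂, N, K, R, hD₁, hD₂, hN, hK, hR, h1, h2, h3, h4⟩ := hV
  obtain ⟨D₁', D₂', N', K', R', hD₁', hD₂', hN', hK', hR', h1', h2', h3', h4'⟩ := hW
  obtain rfl := hD₁.unique hD₁'
  obtain rfl := hD₂.unique hD₂'
  obtain rfl := hN.unique hN'
  obtain rfl : K = K' := funext fun n => funext fun k => (hK n k).unique (hK' n k)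
  obtain rfl : R = R' := funext fun n => funext fun j => funext fun k =>
    (hR n j k).unique (hR' n j k)
  refine Phase.eq_of_components (Lp.ext (h1.trans h1'.symm)) (Lp.ext (h2.trans h2'.symm)) ?_ ?_
  · refine lp.ext (funext fun n => ?_)
    ext j
    rw [h3, h3']
  · refine lp.ext (funext fun n => ?_)
    ext j
    rw [h4, h4']

lemma memLp_schrodinger (hΦ : MemH2Per Φ) (D u : L2) :
    MemLp (fun x => 2 * ((1 / 2) * D x - e * Φ x * u x - freq * u x)) 2 volume := by
  have h := (((Lp.memLp D).const_mul (1 / 2 : ℂ)).sub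
    ((hΦ.memLp_mul (Lp.memLp u)).const_mul (e : ℂ))).sub ((Lp.memLp u).const_mul (freq : ℂ))
  refine (memLp_congr_ae (Filter.Eventually.of_forall fun x => ?_)).1 (h.const_mul (2 : ℂ))
  simp only [Pi.sub_apply]
  ring

lemma exists_isHessian (hσ : MemLp (fun x => (1 + ‖x‖ ^ 2) * σ x) 2 (volume : Measure R3))
    (hψ : MemH2Per ψ) (hΦ : MemH2Per Φ) {Y : Phase} (hY : Y ∈ core) :
    ∃ W, IsHessian e M σ ψ Φ freq Y W := by
  obtain ⟨⟨φ₁, hφ₁, hY₁⟩, ⟨φ₂, hφ₂, hY₂⟩, hQ, hP⟩ := hY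
  obtain ⟨s, hs⟩ := exists_finset_of_mem_seqFin hQ
  have hσ2 := memLp_two_of_weight hσ
  have hσ1 := integrable_of_weight hσ
  obtain ⟨D₁, hD₁⟩ := exists_isMultiplier_symbNegLap φ₁
  obtain ⟨D₂, hD₂⟩ := exists_isMultiplier_symbNegLap φ₂
  obtain ⟨N, hN⟩ := exists_isMultiplier_symbG_periodic_mul hψ hφ₁
  choose K hK using exists_isMultiplier_symbG_mul_symbPartial hσ1 hσ2
  choose R hR using exists_isMultiplier_symbG_mul_symbPartial_mul_symbPartial hσ2
  rw [← hY₁] at hD₁ hN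
  rw [← hY₂] at hD₂
  have hw1 : MemLp (fun x =>
      2 * ((1 / 2) * D₁ x - e * Φ x * Y.psi1 x - freq * Y.psi1 x)
        + 4 * e ^ 2 * ψ x * N x
        + 2 * ∑' n, ∑ k, e * ψ x * K n k x * Y.posn n k) 2 volume := by
    have h2 : MemLp (fun x => 4 * (e : ℂ) ^ 2 * ψ x * N x) 2 volume := by
      refine (memLp_congr_ae (Filter.Eventually.of_forall fun x => ?_)).1
        ((hψ.memLp_mul (Lp.memLp N)).const_mul (4 * (e : ℂ) ^ 2))
      ring
    have h3 : MemLp (fun x => ∑ n ∈ s, ∑ k, (e : ℂ) * ψ x * K n k x * Y.posn n k) 2 volume := by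
      refine memLp_finsetSum _ fun n _ => memLp_finsetSum _ fun k _ => ?_
      refine (memLp_congr_ae (Filter.Eventually.of_forall fun x => ?_)).1
        ((hψ.memLp_mul (Lp.memLp (K n k))).const_mul ((e : ℂ) * Y.posn n k))
      simp only
      ring
    refine (memLp_congr_ae (Filter.Eventually.of_forall fun x => ?_)).1
      (((memLp_schrodinger (e := e) (freq := freq) hΦ D₁ Y.psi1).add h2).add (h3.const_mul (2 : ℂ)))
    have ht : ∑' n, ∑ k, (e : ℂ) * ψ x * K n k x * Y.posn n k =
        ∑ n ∈ s, ∑ k, (e : ℂ) * ψ x * K n k x * Y.posn n k :=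
      tsum_eq_sum fun n hn => by simp [hs n hn]
    rw [ht]
    rfl
  have hw3 : Memℓp (E := fun _ : Z3 => EuclideanSpace ℂ (Fin 3)) (fun n => WithLp.toLp 2 fun j =>
      2 * (∫ x, (starRingEnd ℂ) (e * ψ x * K n j x) * Y.psi1 x)
        + ∑' n', ∑ k, matT σ Φ R n n' j k * Y.posn n' k) 2 := by
    refine memℓp_two_of_forall_coord fun j => ?_
    have h1 : Summable fun n => ‖2 * ∫ x, (starRingEnd ℂ) (e * ψ x * K n j x) * Y.psi1 x‖ ^ 2 := by
      rw [hY₁]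
      exact summable_sq_norm_const_mul 2 (summable_sq_coupling hσ hψ hφ₁ hK j)
    have h2 : Summable fun n => ‖∑' n', ∑ k, matT σ Φ R n n' j k * Y.posn n' k‖ ^ 2 := by
      have ht : ∀ n, ∑' n', ∑ k, matT σ Φ R n n' j k * Y.posn n' k =
          ∑ n' ∈ s, ∑ k, Y.posn n' k * matT σ Φ R n n' j k := fun n => by
        rw [tsum_eq_sum (s := s) fun n' hn' => by simp [hs n' hn']]
        simp only [mul_comm]
      simp only [ht]
      exact summable_sq_norm_sum s fun n' => summable_sq_norm_sum _ fun k =>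
        summable_sq_norm_const_mul _ (summable_sq_matT hσ R n' j k)
    exact summable_sq_norm_add h1 h2
  have hw2 := memLp_schrodinger (e := e) (freq := freq) hΦ D₂ Y.psi2
  let W : Phase := WithLp.toLp 2 (hw1.toLp _, WithLp.toLp 2 (hw2.toLp _,
    WithLp.toLp 2 ((⟨_, hw3⟩ : SeqL2), (M : ℂ)⁻¹ • Y.mom)))
  exact ⟨W, D₁, D₂, N, K, R, hD₁, hD₂, hN, hK, hR, hw1.coeFn_toLp, hw2.coeFn_toLp,
    fun n j => rfl, fun n j => rfl⟩

end Hessian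

/-! ### Lower bound of the Schrödinger part -/

lemma symbNegLap_eq_ofReal (η : R3) : symbNegLap η = ((2 * Real.pi * ‖η‖) ^ 2 : ℝ) := by
  rw [symbNegLap]; push_cast; ring

lemma conj_symbNegLap (η : R3) : (starRingEnd ℂ) (symbNegLap η) = symbNegLap η := by
  rw [symbNegLap_eq_ofReal, Complex.conj_ofReal]

lemma conj_symbG (η : R3) : (starRingEnd ℂ) (symbG η) = symbG η := by
  rw [symbG, map_inv₀, conj_symbNegLap]

lemma conj_symbPartial (k : Fin 3) (η : R3) :
    (starRingEnd ℂ) (symbPartial k η) = -symbPartial k η := by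
  have h2 : (starRingEnd ℂ) (2 : ℂ) = 2 := map_ofNat _ 2
  simp only [symbPartial, map_mul, h2, Complex.conj_ofReal, Complex.conj_I]
  ring

/-- `-Δ` is real and non-negative. -/
lemma inner_symbNegLap {u D : L2} (h : IsMultiplier symbNegLap u D) :
    (inner ℂ u D : ℂ).im = 0 ∧ 0 ≤ (inner ℂ u D : ℂ).re := by
  have h1 : (inner ℂ u D : ℂ) =
      ((∫ η, (2 * Real.pi * ‖η‖) ^ 2 * ‖(𝓕 u : L2) η‖ ^ 2 : ℝ) : ℂ) := by
    rw [inner_L2_eq_integral_fourier, ← integral_complex_ofReal]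
    refine integral_congr_ae ?_
    filter_upwards [h.fourier_ae_eq (Lp.memLp u)] with η hη
    rw [hη, Lp.toLp_coeFn, symbNegLap_eq_ofReal, mul_left_comm, Complex.conj_mul']
    push_cast
    rfl
  rw [h1, Complex.ofReal_im, Complex.ofReal_re]
  exact ⟨rfl, integral_nonneg fun η => by positivity⟩

section Potential

variable {Φ : R3 → ℝ}

lemma inner_periodic_mul (hΦ : MemH2Per Φ) (u v : L2) :
    inner ℂ u ((hΦ.memLp_mul (Lp.memLp v)).toLp _) =
      inner ℂ ((hΦ.memLp_mul (Lp.memLp u)).toLp _) v := by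
  rw [inner_L2_eq_integral, inner_L2_eq_integral]
  refine integral_congr_ae ?_
  filter_upwards [(hΦ.memLp_mul (Lp.memLp v)).coeFn_toLp,
    (hΦ.memLp_mul (Lp.memLp u)).coeFn_toLp] with x h1 h2
  rw [h1, h2, map_mul, Complex.conj_ofReal]
  ring

lemma norm_periodic_mul_le (hΦ : MemH2Per Φ) {B : ℝ} (hB : ∀ᵐ x, |Φ x| ≤ B) (u : L2) :
    ‖(hΦ.memLp_mul (Lp.memLp u)).toLp _‖ ≤ B * ‖u‖ := by
  refine Lp.norm_le_mul_norm_of_ae_le_mul ?_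
  filter_upwards [(hΦ.memLp_mul (Lp.memLp u)).coeFn_toLp, hB] with x h1 h2
  rw [h1, norm_mul, Complex.norm_real]
  gcongr
  exact h2

/-- `2H⁰ = -Δ - 2eΦ⁰ - 2ω⁰` is symmetric and bounded from below. -/
lemma inner_schrodinger {e freq B : ℝ} (he : 0 ≤ e) (hΦ : MemH2Per Φ) (hB : ∀ᵐ x, |Φ x| ≤ B)
    {u D : L2} (h : IsMultiplier symbNegLap u D) :
    (inner ℂ u ((memLp_schrodinger (e := e) (freq := freq) hΦ D u).toLp _) : ℂ).im = 0 ∧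
    -(2 * (e * B + |freq|)) * ‖u‖ ^ 2 ≤
      (inner ℂ u ((memLp_schrodinger (e := e) (freq := freq) hΦ D u).toLp _) : ℂ).re := by
  set g : L2 := (hΦ.memLp_mul (Lp.memLp u)).toLp _ with hg
  have h1 : (memLp_schrodinger (e := e) (freq := freq) hΦ D u).toLp _ =
      D - ((2 * e : ℝ) : ℂ) • g - ((2 * freq : ℝ) : ℂ) • u := by
    refine Lp.ext ?_
    filter_upwards [(memLp_schrodinger (e := e) (freq := freq) hΦ D u).coeFn_toLp,
      Lp.coeFn_sub (D - ((2 * e : ℝ) : ℂ) • g) (((2 * freq : ℝ) : ℂ) • u),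
      Lp.coeFn_sub D (((2 * e : ℝ) : ℂ) • g), Lp.coeFn_smul ((2 * e : ℝ) : ℂ) g,
      Lp.coeFn_smul ((2 * freq : ℝ) : ℂ) u,
      (hΦ.memLp_mul (Lp.memLp u)).coeFn_toLp] with x h1 h2 h3 h4 h5 h6
    rw [h1, h2, Pi.sub_apply, h3, Pi.sub_apply, h4, h5, Pi.smul_apply, Pi.smul_apply, hg, h6]
    simp only [smul_eq_mul]
    push_cast
    ring
  have hgs : (inner ℂ u g : ℂ).im = 0 := by
    have h2 : (inner ℂ u g : ℂ) = inner ℂ g u := inner_periodic_mul hΦ u u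
    refine Complex.conj_eq_iff_im.1 ?_
    conv_lhs => rw [h2]
    exact inner_conj_symm u g
  have hgb : |(inner ℂ u g : ℂ).re| ≤ B * ‖u‖ ^ 2 := by
    calc _ ≤ ‖(inner ℂ u g : ℂ)‖ := Complex.abs_re_le_norm _
      _ ≤ ‖u‖ * ‖g‖ := norm_inner_le_norm _ _
      _ ≤ ‖u‖ * (B * ‖u‖) := by gcongr; exact norm_periodic_mul_le hΦ hB u
      _ = _ := by ring
  obtain ⟨hD1, hD2⟩ := inner_symbNegLap h
  have hu : (inner ℂ u u : ℂ) = ((‖u‖ ^ 2 : ℝ) : ℂ) := by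
    rw [inner_self_eq_norm_sq_to_K]; push_cast; rfl
  rw [h1, inner_sub_right, inner_sub_right, inner_smul_right, inner_smul_right, hu]
  simp only [Complex.sub_im, Complex.sub_re, Complex.re_ofReal_mul, Complex.im_ofReal_mul,
    Complex.ofReal_re, Complex.ofReal_im]
  refine ⟨by rw [hD1, hgs]; ring, ?_⟩
  have h4 := mul_le_mul_of_nonneg_left ((le_abs_self _).trans hgb) he
  have h5 := mul_le_mul_of_nonneg_right (le_abs_self freq) (sq_nonneg ‖u‖)
  nlinarith

end Potential

/-! ### The onsite matrix -/

/-- Second derivatives of test functions are symmetric. Equality of the predicates themselves makes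
the chosen function in `weakDeriv` literally the same, so the on-site matrix is symmetric. -/
lemma isWeakDeriv_swap (a b : R3) (f : R3 → ℝ) :
    IsWeakDeriv ![a, b] f = IsWeakDeriv ![b, a] f := by
  funext g
  have : ∀ φ : R3 → ℝ, IsTest φ → ∀ x,
      iteratedFDeriv ℝ 2 φ x ![a, b] = iteratedFDeriv ℝ 2 φ x ![b, a] := fun φ hφ x => by
    have hs : IsSymmSndFDerivAt ℝ φ x :=
      hφ.1.contDiffAt.isSymmSndFDerivAt (by simpa using WithTop.coe_le_coe.2 (le_top : (2 : ℕ∞) ≤ ⊤))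
    rw [iteratedFDeriv_two_apply, iteratedFDeriv_two_apply]
    exact hs a b
  unfold IsWeakDeriv
  refine propext (and_congr_right fun _ => forall₂_congr fun φ hφ => ?_)
  simp only [this φ hφ]

lemma weakDeriv_swap (a b : R3) (f : R3 → ℝ) : weakDeriv ![a, b] f = weakDeriv ![b, a] f := by
  unfold weakDeriv
  rw [isWeakDeriv_swap a b f]

/-- A real symmetric `3 × 3` matrix defines a real quadratic form bounded from below. -/
lemma symmetric_form_bound {τ : Fin 3 → Fin 3 → ℝ} (hτ : ∀ j k, τ j k = τ k j)
    (q : EuclideanSpace ℂ (Fin 3)) :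
    (∑ j, ∑ k, (starRingEnd ℂ) (q j) * ((τ j k : ℂ) * q k)).im = 0 ∧
    -(∑ j, ∑ k, |τ j k|) * ‖q‖ ^ 2 ≤
      (∑ j, ∑ k, (starRingEnd ℂ) (q j) * ((τ j k : ℂ) * q k)).re := by
  constructor
  · rw [← Complex.conj_eq_iff_im, map_sum]
    simp only [map_sum, map_mul, Complex.conj_conj, Complex.conj_ofReal]
    rw [Finset.sum_comm]
    refine Finset.sum_congr rfl fun j _ => Finset.sum_congr rfl fun k _ => ?_
    rw [hτ k j]
    ring
  · have h : ‖∑ j, ∑ k, (starRingEnd ℂ) (q j) * ((τ j k : ℂ) * q k)‖ ≤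
        (∑ j, ∑ k, |τ j k|) * ‖q‖ ^ 2 := by
      rw [Finset.sum_mul]
      refine (norm_sum_le _ _).trans (Finset.sum_le_sum fun j _ => ?_)
      rw [Finset.sum_mul]
      refine (norm_sum_le _ _).trans (Finset.sum_le_sum fun k _ => ?_)
      rw [norm_mul, norm_mul, RCLike.norm_conj, Complex.norm_real, Real.norm_eq_abs]
      have h1 := PiLp.norm_apply_le q j
      have h2 := PiLp.norm_apply_le q k
      calc _ = |τ j k| * (‖q j‖ * ‖q k‖) := by ring
        _ ≤ |τ j k| * (‖q‖ * ‖q‖) := by gcongr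
        _ = _ := by ring
    have := neg_abs_le (∑ j, ∑ k, (starRingEnd ℂ) (q j) * ((τ j k : ℂ) * q k)).re
    linarith [Complex.abs_re_le_norm (∑ j, ∑ k, (starRingEnd ℂ) (q j) * ((τ j k : ℂ) * q k))]

/-! ### The Coulomb energy as a square -/

/-- The square root `2π|η|` of the symbol of `-Δ`. -/
def symbSqrt (η : R3) : ℂ := (2 * Real.pi * ‖η‖ : ℝ)

lemma measurable_symbSqrt : Measurable symbSqrt := by
  unfold symbSqrt; fun_prop

lemma conj_symbSqrt (η : R3) : (starRingEnd ℂ) (symbSqrt η) = symbSqrt η := Complex.conj_ofReal _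

lemma symbSqrt_sq (η : R3) : symbSqrt η ^ 2 = symbNegLap η := rfl

lemma symbSqrt_ne_zero {η : R3} (h : η ≠ 0) : symbSqrt η ≠ 0 := by
  rw [symbSqrt]
  have := Real.pi_pos
  have := norm_pos_iff.2 h
  exact_mod_cast (by positivity : 2 * Real.pi * ‖η‖ ≠ 0)

lemma symbNegLap_ne_zero {η : R3} (h : η ≠ 0) : symbNegLap η ≠ 0 :=
  pow_ne_zero 2 (symbSqrt_ne_zero h)

lemma ae_ne_zero : ∀ᵐ η : R3, η ≠ 0 := by
  have : (volume : Measure R3) {0} = 0 := measure_singleton 0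
  exact measure_eq_zero_iff_ae_notMem.1 this

lemma norm_symbSqrt (η : R3) : ‖symbSqrt η‖ = 2 * Real.pi * ‖η‖ := by
  rw [symbSqrt, Complex.norm_real, Real.norm_of_nonneg (by positivity)]

/-- `(-Δ)^{-1/2} f`, on the Fourier side, is square integrable if `G f` is. -/
lemma memLp_symbSqrt_inv {f N : L2} (h : IsMultiplier symbG f N) :
    MemLp (fun η => (symbSqrt η)⁻¹ * (𝓕 f : L2) η) 2 volume := by
  have hb := (Lp.memLp (𝓕 f : L2)).norm.add (Lp.memLp (𝓕 N : L2)).norm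
  refine hb.mono
    (measurable_symbSqrt.inv.aestronglyMeasurable.mul (Lp.aestronglyMeasurable _)) ?_
  filter_upwards [h.fourier_ae_eq (Lp.memLp f)] with η hη
  rw [Pi.add_apply, hη, Lp.toLp_coeFn, Real.norm_of_nonneg (by positivity), norm_mul, norm_mul,
    norm_symbG, norm_inv, norm_symbSqrt]
  set a := (2 * Real.pi * ‖η‖)⁻¹ with ha
  -- The symbol of `(-Δ)^{-1/2}` is dominated by the sum of those of the identity and of `G`.
  have h1 : a ≤ 1 + a ^ 2 := by nlinarith [sq_nonneg (a - 1), sq_nonneg a]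
  calc _ ≤ (1 + a ^ 2) * ‖(𝓕 f : L2) η‖ := by gcongr
    _ = _ := by rw [ha, inv_pow]; ring

section Density

variable {g h : R3 → ℂ}

/-- `(-Δ)^{1/2} G ∂ₖ g`, on the Fourier side, is square integrable. -/
lemma memLp_symbSqrt_mul {k : Fin 3} {v : L2}
    (hv : IsMultiplier (fun η => symbG η * symbPartial k η) g v) :
    MemLp (fun η => symbSqrt η * (𝓕 v : L2) η) 2 volume := by
  refine (Lp.memLp (𝓕 (hv.memLp.toLp g) : L2)).mono
    (measurable_symbSqrt.aestronglyMeasurable.mul (Lp.aestronglyMeasurable _)) ?_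
  filter_upwards [hv.fourier_ae_eq hv.memLp] with η hη
  rw [hη, ← mul_assoc, norm_mul]
  refine mul_le_of_le_one_left (norm_nonneg _) ?_
  rw [norm_mul, norm_mul, norm_symbSqrt, norm_symbG]
  by_cases h0 : ‖η‖ = 0
  · simp [h0]
  have hη : 0 < ‖η‖ := lt_of_le_of_ne (norm_nonneg _) (Ne.symm h0)
  calc _ ≤ (2 * Real.pi * ‖η‖) * (((2 * Real.pi * ‖η‖) ^ 2)⁻¹ * (2 * Real.pi * ‖η‖)) := by
        gcongr
        exact norm_symbPartial_le k η
    _ = 1 := by have := Real.pi_pos; field_simp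

/-- The factors `(2π|η|)⁻¹` and `2π|η|` cancel away from the origin. The coupling is thereby
expressed through the vectors that also generate the Coulomb part of `T`, as completing the square
requires. -/
lemma inner_eq_inner_sqrt_inv_sqrt {f N v : L2} (hN : IsMultiplier symbG f N) {k : Fin 3}
    (hv : IsMultiplier (fun η => symbG η * symbPartial k η) g v) :
    inner ℂ f v = inner ℂ ((memLp_symbSqrt_inv hN).toLp _) ((memLp_symbSqrt_mul hv).toLp _) := by
  rw [inner_L2_eq_integral_fourier, inner_L2_eq_integral]
  refine integral_congr_ae ?_
  filter_upwards [(memLp_symbSqrt_inv hN).coeFn_toLp, (memLp_symbSqrt_mul hv).coeFn_toLp,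
    ae_ne_zero] with η h1 h2 h0
  have := symbSqrt_ne_zero h0
  rw [h1, h2, map_mul, map_inv₀, conj_symbSqrt]
  field_simp

lemma inner_eq_inner_sqrt_inv {f N : L2} (hN : IsMultiplier symbG f N) :
    inner ℂ f N = inner ℂ ((memLp_symbSqrt_inv hN).toLp _) ((memLp_symbSqrt_inv hN).toLp _) := by
  rw [inner_L2_eq_integral_fourier, inner_L2_eq_integral]
  refine integral_congr_ae ?_
  filter_upwards [(memLp_symbSqrt_inv hN).coeFn_toLp, hN.fourier_ae_eq (Lp.memLp f)] with η h1 h2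
  rw [h1, h2, Lp.toLp_coeFn, map_mul, map_inv₀, conj_symbSqrt, symbG, ← symbSqrt_sq]
  ring

/-- `-⟨h, G∂ⱼ∂ₖ g⟩ = ⟨G∂ⱼ h, (-Δ) G∂ₖ g⟩`. -/
lemma neg_integral_eq_inner_sqrt {j k : Fin 3} {v w r : L2}
    (hv : IsMultiplier (fun η => symbG η * symbPartial j η) h v)
    (hw : IsMultiplier (fun η => symbG η * symbPartial k η) g w)
    (hr : IsMultiplier (fun η => symbG η * symbPartial j η * symbPartial k η) g r) :
    -∫ x, r x * (starRingEnd ℂ) (h x) =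
      inner ℂ ((memLp_symbSqrt_mul hv).toLp _) ((memLp_symbSqrt_mul hw).toLp _) := by
  have hh := hv.memLp
  have hg := hw.memLp
  have h1 : ∫ x, r x * (starRingEnd ℂ) (h x) = inner ℂ (hh.toLp h) r := by
    rw [inner_L2_eq_integral]
    refine integral_congr_ae ?_
    filter_upwards [hh.coeFn_toLp] with x hx
    rw [hx, mul_comm]
  rw [h1, inner_L2_eq_integral_fourier, inner_L2_eq_integral, ← integral_neg]
  refine integral_congr_ae ?_
  filter_upwards [(memLp_symbSqrt_mul hv).coeFn_toLp, (memLp_symbSqrt_mul hw).coeFn_toLp,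
    hv.fourier_ae_eq hh, hw.fourier_ae_eq hg, hr.fourier_ae_eq hg, ae_ne_zero]
    with η h1 h2 h3 h4 h5 h0
  have hs := symbNegLap_ne_zero h0
  rw [h1, h2, h3, h4, h5]
  -- Conjugation flips the sign of `symbPartial j`; this absorbs the minus sign on the left and
  -- leaves a Gram product.
  simp only [map_mul, conj_symbSqrt, conj_symbG, conj_symbPartial]
  have h6 : symbSqrt η * symbSqrt η * symbG η = 1 := by
    rw [← sq, symbSqrt_sq, symbG, mul_inv_cancel₀ hs]
  linear_combination ((symbG η) * (symbPartial j η) * (starRingEnd ℂ) ((𝓕 (hh.toLp h) : L2) η) *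
    (symbPartial k η) * (𝓕 (hg.toLp g) : L2) η) * h6

end Density

/-! ### The energy form -/

lemma Phase.inner_eq (Y W : Phase) : (inner ℂ Y W : ℂ) =
    inner ℂ Y.psi1 W.psi1 + (inner ℂ Y.psi2 W.psi2 +
      (inner ℂ Y.posn W.posn + inner ℂ Y.mom W.mom)) := by
  rw [WithLp.prod_inner_apply, WithLp.prod_inner_apply, WithLp.prod_inner_apply]
  rfl

lemma Phase.norm_sq_eq (Y : Phase) : ‖Y‖ ^ 2 =
    ‖Y.psi1‖ ^ 2 + (‖Y.psi2‖ ^ 2 + (‖Y.posn‖ ^ 2 + ‖Y.mom‖ ^ 2)) := by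
  rw [WithLp.prod_norm_sq_eq_of_L2, WithLp.prod_norm_sq_eq_of_L2, WithLp.prod_norm_sq_eq_of_L2]

lemma inner_seq_eq_sum {Q V : SeqL2} {s : Finset Z3} (hs : ∀ n ∉ s, Q n = 0) :
    (inner ℂ Q V : ℂ) = ∑ n ∈ s, ∑ j, (starRingEnd ℂ) (Q n j) * V n j := by
  rw [lp.inner_eq_tsum, tsum_eq_sum (s := s) fun n hn => by rw [hs n hn, inner_zero_left]]
  refine Finset.sum_congr rfl fun n _ => ?_
  rw [PiLp.inner_apply]
  exact Finset.sum_congr rfl fun j _ => by rw [RCLike.inner_apply, mul_comm]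

lemma norm_sq_seq_eq_sum {Q : SeqL2} {s : Finset Z3} (hs : ∀ n ∉ s, Q n = 0) :
    ‖Q‖ ^ 2 = ∑ n ∈ s, ‖Q n‖ ^ 2 := by
  have h := lp.norm_rpow_eq_tsum (p := 2) (by norm_num) Q
  simp only [ENNReal.toReal_ofNat, Real.rpow_ofNat] at h
  rw [h, tsum_eq_sum (s := s) fun n hn => by rw [hs n hn, norm_zero]; norm_num]

section Form

variable {e M : ℝ} {σ ψ Φ : R3 → ℝ} {freq : ℝ}

/-- The `Ψ₁` component of the energy form. -/
lemma inner_psi1_eq (hψ : MemH2Per ψ) (hΦ : MemH2Per Φ) {u w D N : L2} {K : Z3 → Fin 3 → L2}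
    {Q : SeqL2} {s : Finset Z3} (hs : ∀ n ∉ s, Q n = 0)
    (hw : w =ᵐ[volume] fun x =>
      2 * ((1 / 2) * D x - e * Φ x * u x - freq * u x)
        + 4 * e ^ 2 * ψ x * N x + 2 * ∑' n, ∑ k, e * ψ x * K n k x * Q n k) :
    (inner ℂ u w : ℂ) =
      inner ℂ u ((memLp_schrodinger (e := e) (freq := freq) hΦ D u).toLp _) +
      4 * (e : ℂ) ^ 2 * inner ℂ ((hψ.memLp_mul (Lp.memLp u)).toLp _) N +
      2 * (e : ℂ) * ∑ n ∈ s, ∑ k, Q n k *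
        inner ℂ ((hψ.memLp_mul (Lp.memLp u)).toLp _) (K n k) := by
  -- `V` is the potential generated by the displacements `Q`, so that `ψV` is the whole coupling
  -- term up to `2e`.
  set V : L2 := ∑ n ∈ s, ∑ k, Q n k • K n k with hV
  have hVx : ∀ᵐ x, V x = ∑ n ∈ s, ∑ k, Q n k * K n k x := by
    have h1 : ∀ᵐ x, ∀ n : Z3, ∀ k : Fin 3, (Q n k • K n k : L2) x = Q n k * K n k x :=
      ae_all_iff.2 fun n => ae_all_iff.2 fun k => Lp.coeFn_smul (Q n k) (K n k)
    have h2 : ∀ᵐ x, ∀ n : Z3, (∑ k, Q n k • K n k : L2) x = ∑ k, (Q n k • K n k : L2) x :=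
      ae_all_iff.2 fun n => by
        filter_upwards [Lp.coeFn_finsetSum Finset.univ fun k => Q n k • K n k] with x hx
        rw [hx, Finset.sum_apply]
    filter_upwards [h1, h2, Lp.coeFn_finsetSum s fun n => ∑ k, Q n k • K n k] with x h1 h2 h3
    rw [hV, h3, Finset.sum_apply]
    simp only [h2, h1]
  have hdec : w = (memLp_schrodinger (e := e) (freq := freq) hΦ D u).toLp _ +
      (4 * (e : ℂ) ^ 2) • (hψ.memLp_mul (Lp.memLp N)).toLp _ +
      (2 * (e : ℂ)) • (hψ.memLp_mul (Lp.memLp V)).toLp _ := by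
    refine Lp.ext ?_
    filter_upwards [hw, (memLp_schrodinger (e := e) (freq := freq) hΦ D u).coeFn_toLp,
      (hψ.memLp_mul (Lp.memLp N)).coeFn_toLp, (hψ.memLp_mul (Lp.memLp V)).coeFn_toLp, hVx,
      Lp.coeFn_add ((memLp_schrodinger (e := e) (freq := freq) hΦ D u).toLp _ +
        (4 * (e : ℂ) ^ 2) • (hψ.memLp_mul (Lp.memLp N)).toLp _)
        ((2 * (e : ℂ)) • (hψ.memLp_mul (Lp.memLp V)).toLp _),
      Lp.coeFn_add ((memLp_schrodinger (e := e) (freq := freq) hΦ D u).toLp _)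
        ((4 * (e : ℂ) ^ 2) • (hψ.memLp_mul (Lp.memLp N)).toLp _),
      Lp.coeFn_smul (4 * (e : ℂ) ^ 2) ((hψ.memLp_mul (Lp.memLp N)).toLp _),
      Lp.coeFn_smul (2 * (e : ℂ)) ((hψ.memLp_mul (Lp.memLp V)).toLp _)]
      with x h1 h2 h3 h4 h5 h6 h7 h8 h9
    rw [h1, h6, Pi.add_apply, h7, Pi.add_apply, h8, h9, Pi.smul_apply, Pi.smul_apply, h2, h3, h4,
      h5, tsum_eq_sum (s := s) fun n hn => by simp [hs n hn]]
    simp only [smul_eq_mul, Finset.mul_sum]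
    congr 1
    · ring
    · exact Finset.sum_congr rfl fun n _ => Finset.sum_congr rfl fun k _ => by ring
  rw [hdec, inner_add_right, inner_add_right, inner_smul_right, inner_smul_right,
    inner_periodic_mul hψ, inner_periodic_mul hψ, hV, inner_sum]
  simp only [inner_sum, inner_smul_right]

lemma coupling_eq_inner (hψ : MemH2Per ψ) (u v : L2) :
    ∫ x, (starRingEnd ℂ) (e * ψ x * v x) * u x =
      (e : ℂ) * inner ℂ v ((hψ.memLp_mul (Lp.memLp u)).toLp _) := by
  rw [inner_L2_eq_integral, ← integral_const_mul]
  refine integral_congr_ae ?_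
  filter_upwards [(hψ.memLp_mul (Lp.memLp u)).coeFn_toLp] with x hx
  rw [hx]
  simp only [map_mul, Complex.conj_ofReal]
  ring

/-- The onsite matrix `⟨Φ⁰, ∂ⱼ∂ₖσ⟩`. -/
def onsite (σ Φ : R3 → ℝ) (j k : Fin 3) : ℝ :=
  ∫ x, weakDeriv ![basisVec j, basisVec k] Φ x * σ x

lemma onsite_symm (j k : Fin 3) : onsite σ Φ j k = onsite σ Φ k j := by
  rw [onsite, weakDeriv_swap, onsite]

/-- The Coulomb part of `T` is the Gram matrix of the vectors `(-Δ)^{1/2} G∂ₖσ(·-n)`; that `σ` is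
real allows the conjugate to be inserted. -/
lemma matT_eq {K : Z3 → Fin 3 → L2} {R : Z3 → Fin 3 → Fin 3 → L2}
    (hK : ∀ n k, IsMultiplier (fun η => symbG η * symbPartial k η)
      (fun x => (σ (x - latt n) : ℂ)) (K n k))
    (hR : ∀ n j k, IsMultiplier (fun η => symbG η * symbPartial j η * symbPartial k η)
      (fun x => (σ (x - latt n) : ℂ)) (R n j k)) (n n' : Z3) (j k : Fin 3) :
    matT σ Φ R n n' j k =
      inner ℂ ((memLp_symbSqrt_mul (hK n j)).toLp _) ((memLp_symbSqrt_mul (hK n' k)).toLp _) +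
        if n = n' then (onsite σ Φ j k : ℂ) else 0 := by
  rw [← neg_integral_eq_inner_sqrt (hK n j) (hK n' k) (hR n' j k)]
  simp only [Complex.conj_ofReal]
  rfl

/-- The interaction part of the energy form is the square of a norm, up to the onsite term. -/
lemma energy_form_eq (hψ : MemH2Per ψ) (hΦ : MemH2Per Φ) {Y W : Phase} {s : Finset Z3}
    (hs : ∀ n ∉ s, Y.posn n = 0) (hW : IsHessian e M σ ψ Φ freq Y W) :
    ∃ (D₁ D₂ X : L2), IsMultiplier symbNegLap Y.psi1 D₁ ∧ IsMultiplier symbNegLap Y.psi2 D₂ ∧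
      (inner ℂ Y W : ℂ) =
        inner ℂ Y.psi1 ((memLp_schrodinger (e := e) (freq := freq) hΦ D₁ Y.psi1).toLp _) +
        inner ℂ Y.psi2 ((memLp_schrodinger (e := e) (freq := freq) hΦ D₂ Y.psi2).toLp _) +
        inner ℂ X X +
        ∑ n ∈ s, ∑ j, ∑ k, (starRingEnd ℂ) (Y.posn n j) * ((onsite σ Φ j k : ℂ) * Y.posn n k) +
        (M : ℂ)⁻¹ * inner ℂ Y.mom Y.mom := by
  obtain ⟨D₁, D₂, N, K, R, hD₁, hD₂, hN, hK, hR, h1, h2, h3, h4⟩ := hW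
  set f : L2 := (hψ.memLp_mul (Lp.memLp Y.psi1)).toLp _ with hf
  have hNf : IsMultiplier symbG f N := hN.congr (MemLp.coeFn_toLp _).symm
  set A : L2 := (memLp_symbSqrt_inv hNf).toLp _ with hA
  set V : Z3 → Fin 3 → L2 := fun n k => (memLp_symbSqrt_mul (hK n k)).toLp _ with hV
  set T : L2 := ∑ n ∈ s, ∑ k, Y.posn n k • V n k with hT
  have hfK : ∀ n k, (inner ℂ f (K n k) : ℂ) = inner ℂ A (V n k) := fun n k =>
    inner_eq_inner_sqrt_inv_sqrt hNf (hK n k)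
  have hKf : ∀ n k, (inner ℂ (K n k) f : ℂ) = inner ℂ (V n k) A := fun n k => by
    rw [← inner_conj_symm, hfK, inner_conj_symm]
  have hAT : (inner ℂ A T : ℂ) = ∑ n ∈ s, ∑ k, Y.posn n k * inner ℂ A (V n k) := by
    simp only [hT, inner_sum, inner_smul_right]
  have hTA : (inner ℂ T A : ℂ) =
      ∑ n ∈ s, ∑ k, (starRingEnd ℂ) (Y.posn n k) * inner ℂ (V n k) A := by
    simp only [hT, sum_inner, inner_smul_left]
  have hTT : (inner ℂ T T : ℂ) = ∑ n ∈ s, ∑ j, (starRingEnd ℂ) (Y.posn n j) *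
      ∑ n' ∈ s, ∑ k, inner ℂ (V n j) (V n' k) * Y.posn n' k := by
    conv_lhs => rw [hT]
    simp only [sum_inner, inner_smul_left]
    refine Finset.sum_congr rfl fun n _ => Finset.sum_congr rfl fun j _ => ?_
    simp only [inner_sum, inner_smul_right, mul_comm]
  -- Expanding the square gives `4e²⟨A, A⟩ + 2e⟨A, T⟩ + 2e⟨T, A⟩ + ⟨T, T⟩`: the Hartree term, the
  -- two coupling terms and the Gram part of the matrix.
  refine ⟨D₁, D₂, (2 * (e : ℂ)) • A + T, hD₁, hD₂, ?_⟩
  have e1 := inner_psi1_eq (K := K) hψ hΦ hs h1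
  have e2 : (inner ℂ Y.psi2 W.psi2 : ℂ) =
      inner ℂ Y.psi2 ((memLp_schrodinger (e := e) (freq := freq) hΦ D₂ Y.psi2).toLp _) := by
    congr 1
    exact Lp.ext (h2.trans (MemLp.coeFn_toLp _).symm)
  have e4 : (inner ℂ Y.mom W.mom : ℂ) = (M : ℂ)⁻¹ * inner ℂ Y.mom Y.mom := by
    rw [← inner_smul_right]
    congr 1
    refine lp.ext (funext fun n => ?_)
    ext j
    rw [h4]
    rfl
  have e3 : (inner ℂ Y.posn W.posn : ℂ) = 2 * (e : ℂ) * inner ℂ T A + inner ℂ T T +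
      ∑ n ∈ s, ∑ j, ∑ k, (starRingEnd ℂ) (Y.posn n j) * ((onsite σ Φ j k : ℂ) * Y.posn n k) := by
    rw [inner_seq_eq_sum hs, hTA, hTT, Finset.mul_sum, ← Finset.sum_add_distrib,
      ← Finset.sum_add_distrib]
    refine Finset.sum_congr rfl fun n hn => ?_
    rw [Finset.mul_sum, ← Finset.sum_add_distrib, ← Finset.sum_add_distrib]
    refine Finset.sum_congr rfl fun j _ => ?_
    have ht : ∑' n', ∑ k, matT σ Φ R n n' j k * Y.posn n' k =
        ∑ n' ∈ s, ∑ k, inner ℂ (V n j) (V n' k) * Y.posn n' k +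
          ∑ k, (onsite σ Φ j k : ℂ) * Y.posn n k := by
      rw [tsum_eq_sum (s := s) fun n' hn' => by simp [hs n' hn']]
      simp only [matT_eq hK hR, add_mul, Finset.sum_add_distrib, ite_mul, zero_mul]
      congr 1
      rw [Finset.sum_eq_single n (fun n' _ hne => by simp [hne.symm])
        (fun h => absurd hn h)]
      simp
    rw [h3, coupling_eq_inner hψ, ← hf, hKf, ht, ← Finset.mul_sum]
    ring
  rw [Phase.inner_eq, e1, e2, e3, e4, inner_eq_inner_sqrt_inv hNf]
  simp only [← hf, hfK]
  rw [← hAT]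
  simp only [inner_add_left, inner_add_right, inner_smul_left, inner_smul_right, map_mul,
    Complex.conj_ofReal, map_ofNat]
  ring

lemma energy_form_bounded_below (he : 0 ≤ e) (hM : 0 ≤ M) (hψ : MemH2Per ψ) (hΦ : MemH2Per Φ) :
    ∃ C : ℝ, ∀ Y ∈ core, ∀ W : Phase, IsHessian e M σ ψ Φ freq Y W →
      (inner ℂ Y W : ℂ).im = 0 ∧ -C * ‖Y‖ ^ 2 ≤ (inner ℂ Y W : ℂ).re := by
  obtain ⟨B, hB0, hB⟩ := hΦ.exists_bound
  set b := 2 * (e * B + |freq|) with hb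
  set t := ∑ j, ∑ k, |onsite σ Φ j k| with ht
  have hb0 : 0 ≤ b := by positivity
  have ht0 : 0 ≤ t := Finset.sum_nonneg fun j _ => Finset.sum_nonneg fun k _ => abs_nonneg _
  -- `b` controls `2H⁰` on `Ψ₁` and `Ψ₂`, `t` controls the on-site form on `Q`; the square and the
  -- momentum term are non-negative.
  refine ⟨b + t, fun Y hY W hW => ?_⟩
  obtain ⟨s, hs⟩ := exists_finset_of_mem_seqFin hY.2.2.1
  obtain ⟨D₁, D₂, X, hD₁, hD₂, hform⟩ := energy_form_eq hψ hΦ hs hW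
  obtain ⟨i1, l1⟩ := inner_schrodinger (freq := freq) he hΦ hB hD₁
  obtain ⟨i2, l2⟩ := inner_schrodinger (freq := freq) he hΦ hB hD₂
  have hself : ∀ {E : Type} [NormedAddCommGroup E] [InnerProductSpace ℂ E] (x : E),
      (inner ℂ x x : ℂ) = ((‖x‖ ^ 2 : ℝ) : ℂ) := fun x => by
    rw [inner_self_eq_norm_sq_to_K]; push_cast; rfl
  have i3 : (∑ n ∈ s, ∑ j, ∑ k, (starRingEnd ℂ) (Y.posn n j) *
      ((onsite σ Φ j k : ℂ) * Y.posn n k)).im = 0 := by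
    rw [Complex.im_sum]
    exact Finset.sum_eq_zero fun n _ => (symmetric_form_bound onsite_symm (Y.posn n)).1
  have l3 : -t * ‖Y.posn‖ ^ 2 ≤ (∑ n ∈ s, ∑ j, ∑ k, (starRingEnd ℂ) (Y.posn n j) *
      ((onsite σ Φ j k : ℂ) * Y.posn n k)).re := by
    rw [Complex.re_sum, norm_sq_seq_eq_sum hs, Finset.mul_sum]
    exact Finset.sum_le_sum fun n _ => (symmetric_form_bound onsite_symm (Y.posn n)).2
  have h4 : (M : ℂ)⁻¹ * inner ℂ Y.mom Y.mom = ((M⁻¹ * ‖Y.mom‖ ^ 2 : ℝ) : ℂ) := by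
    rw [hself]; push_cast; rfl
  rw [hform, hself X, h4]
  simp only [Complex.add_im, Complex.add_re, Complex.ofReal_im, Complex.ofReal_re]
  refine ⟨by rw [i1, i2, i3]; ring, ?_⟩
  have h5 : 0 ≤ M⁻¹ * ‖Y.mom‖ ^ 2 := by positivity
  rw [Phase.norm_sq_eq]
  nlinarith [sq_nonneg ‖X‖, mul_nonneg ht0 (sq_nonneg ‖Y.psi1‖),
    mul_nonneg ht0 (sq_nonneg ‖Y.psi2‖), mul_nonneg hb0 (sq_nonneg ‖Y.posn‖),
    mul_nonneg (add_nonneg hb0 ht0) (sq_nonneg ‖Y.mom‖)]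

end Form

end Crystal

end

open Crystal
theorem theorem6p1 (e Z M : ℝ) (he : 0 < e) (hZ : 0 < Z) (hM : 0 < M)
    (σ : R3 → ℝ) (hσ : ∫ x, σ x = e * Z)
    (hσ2 : MemLp (fun x => (1 + ‖x‖ ^ 2) * σ x) 2 (volume : Measure R3))
    (hσ1 : LapSubOneMemL1 σ)
    (ψ Φ : R3 → ℝ) (freq : ℝ) (hgs : IsGroundState e σ ψ Φ freq) :
    Dense core ∧
    (∀ Y ∈ core, ∃! W : Phase, IsHessian e M σ ψ Φ freq Y W) ∧
    ∃ C : ℝ, ∀ Y ∈ core, ∀ W : Phase, IsHessian e M σ ψ Φ freq Y W →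
      (inner ℂ Y W).im = 0 ∧ -C * ‖Y‖ ^ 2 ≤ (inner ℂ Y W).re := by
  refine ⟨dense_core, fun Y hY => ?_,
    energy_form_bounded_below he.le hM.le hgs.psi_mem hgs.Phi_mem⟩
  obtain ⟨W, hW⟩ := exists_isHessian (e := e) (M := M) (freq := freq) hσ2 hgs.psi_mem hgs.Phi_mem hY
  exact ⟨W, hW, fun V hV => hV.unique hW⟩
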